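/- Let $\mathbb F$ be a finite field with $q$ elements and let $N,K,T,B,E$ be nonnegative integers with $K\ge 2$ and $N>2B+M$, where $M=\max(T,E)$. A database of $K$ independent files $W_1,\dots,W_K$, each uniformly distributed on $\mathbb F^L$ ($L\ge 1$ is chosen by the scheme), is replicated at $N$ servers. The servers share common randomness $S$, the user has private randomness $\mathcal U$, and the desired index $\kappa$ is uniform on $\{1,\dots,K\}$; $\kappa,(W_1,\dots,W_K),\mathcal U,S$ are independent, and all alphabets are finite. If file $k$ is desired, the user sends server $n$ a query $Q_n^{[k]}$ that is a function of $\mathcal U$, and server $n$ answers with $A_n^{[k]}$, a function of $Q_n^{[k]}$, of $W_1,\dots,W_K$, and of a random variable $S_n$ that is a function of $S$. Put $\mathcal Q=(Q_n^{[k]})_{n,k}$. An adversary taps in on the queries and answers of a set $\mathcal E$ of at most $E$ servers and overwrites the answers of a set $\mathcal B$ of at most $B$ servers, depending on what it sees at $\mathcal E$; the sets $\mathcal E$ and $\mathcal B$ are unknown to the user and may intersect. A T-BESPIR scheme is a scheme of this kind such that 1. (zero-error decoding) for every $k$, the user recovers $W_k$ with zero error from $\mathcal Q$, $k$ and the received answers,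 whichever at most $B$ answers are overwritten, and with whatever values; 2. (user-privacy) $I(\kappa;Q^{[\kappa]}_{\mathcal T},A^{[\kappa]}_{\mathcal T},W_{[1:K]},S)=0$ for every set $\mathcal T$ of $T$ servers; 3. (database-privacy) $I(W_{\bar\kappa};A^{[\kappa]}_{[1:N]},\mathcal Q,\kappa)=0$, where $W_{\bar\kappa}$ is the $(K-1)$-tuple of the files other than $W_\kappa$ and $A^{[\kappa]}_{[1:N]}$ are the answers that the user receives, for every such adversary (including one that overwrites nothing); 4. (privacy against the eavesdropper) $I(W_{[1:K]};Q^{[k]}_{\mathcal E},A^{[k]}_{\mathcal E})=0$ for every $k$ and every set $\mathcal E$ of at most $E$ servers. Its rate is $R=H(W_k)/\sum_{n=1}^N H(A^{[k]}_n)$ and its secrecy rate is $\rho=H(S)/H(W_k)$. The capacity at secrecy rate $\rho$ is the supremum of those $R$ for which some T-BESPIR scheme with secrecy rate $\rho$ has rate $R$ for every file index $k$ (and $0$ if there is no such scheme). Then every T-BESPIR scheme satisfies $\rho\ge\frac{M}{N-2B-M}$ and, for every $k$, $R\le 1-\frac{2B+M}{N}$; and for every real $\rho$ the capacity at secrecy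 rate $\rho$ equals $$\begin{cases}1-\dfrac{2B+\max(T,E)}{N}, & \text{if } \rho\ge\dfrac{\max(T,E)}{N-2B-\max(T,E)},\\[2mm] 0,&\text{otherwise.}\end{cases}$$ -/

import Mathlib

/-! ### Entropy and mutual information of finite random variables

`p : Ω → ℝ` is the probability mass function of a finite probability space `Ω`; a random variable
is a function on `Ω`. Entropies are in nats (all quantities below are ratios of entropies). -/

open Classical in
/-- The probability that the random variable `X` takes the value `a`. -/
noncomputable def marginal {Ω α : Type*} [Fintype Ω] (p : Ω → ℝ) (X : Ω → α) (a : α) : ℝ :=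
  ∑ ω, if X ω = a then p ω else 0

/-- The Shannon entropy `H(X)`; `Real.negMulLog x = - x * log x`. -/
noncomputable def entropy {Ω α : Type*} [Fintype Ω] [Fintype α] (p : Ω → ℝ) (X : Ω → α) : ℝ :=
  ∑ a, Real.negMulLog (marginal p X a)

/-- The mutual information `I(X; Y) = H(X) + H(Y) - H(X, Y)`. -/
noncomputable def mutualInfo {Ω α β : Type*} [Fintype Ω] [Fintype α] [Fintype β]
    (p : Ω → ℝ) (X : Ω → α) (Y : Ω → β) : ℝ :=
  entropy p X + entropy p Y - entropy p (fun ω => (X ω, Y ω))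

/-- The tuple of all files except the `k`-th one, in increasing order of their indices. -/
def otherFiles {K : ℕ} {α : Type*} (k : Fin K) (w : Fin K → α) : Fin (K - 1) → α :=
  fun j => if j.1 < k.1 then w ⟨j.1, by omega⟩ else w ⟨j.1 + 1, by omega⟩

/-! ### Protocols -/

/-- A one-round retrieval protocol between a user and `N` servers that all store the same `K` files,
each consisting of `L` symbols of the finite field `F`. All alphabets are finite. -/
structure Protocol (N K : ℕ) (F : Type*) where
  /-- the number of symbols of a file -/
  L : ℕ
  L_pos : 0 < L
  /-- the alphabet of the user's private randomness `𝒰` -/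
  U : Type
  [fintypeU : Fintype U]
  /-- the distribution of `𝒰` -/
  lawU : stdSimplex ℝ U
  /-- the alphabet of the common randomness `S` of the servers -/
  S : Type
  [fintypeS : Fintype S]
  /-- the distribution of `S` -/
  lawS : stdSimplex ℝ S
  /-- the alphabet of the part `S_n` of the common randomness that server `n` uses -/
  R : Fin N → Type
  /-- `S_n` as a function of `S` -/
  nodeRand : ∀ n, S → R n
  /-- the alphabet of the queries to server `n` -/
  Qry : Fin N → Type
  [fintypeQry : ∀ n, Fintype (Qry n)]
  /-- the alphabet of the answers of server `n` -/
  Ans : Fin N → Type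
  [fintypeAns : ∀ n, Fintype (Ans n)]
  /-- `query u k n` is the query to server `n` if file `k` is desired and `𝒰 = u` -/
  query : U → Fin K → ∀ n, Qry n
  /-- the answer of server `n`, computed from its query, the database and `S_n` -/
  respond : ∀ n, Qry n → (Fin K → Fin L → F) → R n → Ans n

attribute [instance] Protocol.fintypeU Protocol.fintypeS Protocol.fintypeQry Protocol.fintypeAns

namespace Protocol

variable {N K : ℕ} {F : Type*} (P : Protocol N K F)

/-- A file: `L` symbols of `F`. -/
abbrev File : Type _ := Fin P.L → F

/-- An outcome `(κ, W, u, s)`: the desired index, the database, the user's private randomness, and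
the common randomness of the servers. -/
abbrev Outcome : Type _ := Fin K × (Fin K → P.File) × P.U × P.S

/-- The desired index `κ`. -/
def index (ω : P.Outcome) : Fin K := ω.1

/-- The database `W_1, …, W_K`. -/
def files (ω : P.Outcome) : Fin K → P.File := ω.2.1

/-- The common randomness `S`. -/
def commonRand (ω : P.Outcome) : P.S := ω.2.2.2

/-- The complete query scheme `𝒬`: the queries to all servers, for all desired indices. -/
def queries (ω : P.Outcome) : Fin K → ∀ n, P.Qry n := P.query ω.2.2.1

/-- The authentic answer `A_n^[k]` of server `n` when file `k` is requested. -/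
def answer (k : Fin K) (n : Fin N) (ω : P.Outcome) : P.Ans n :=
  P.respond n (P.queries ω k n) (P.files ω) (P.nodeRand n (P.commonRand ω))

/-- The transmissions `(Q_n^[k], A_n^[k])`, `n ∈ 𝓝`, into and out of a set `𝓝` of servers. -/
def transmissions (𝓝 : Finset (Fin N)) (k : Fin K) (ω : P.Outcome) :
    ∀ n : 𝓝, P.Qry n × P.Ans n :=
  fun n => (P.queries ω k n, P.answer k n ω)

/-- The answers that reach the user when the adversary taps in on the servers in `𝓔` and, depending
on what it sees there, overwrites the answers of the servers in `𝓑`. -/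
def received (𝓔 𝓑 : Finset (Fin N))
    (attack : (∀ n : 𝓔, P.Qry n × P.Ans n) → ∀ n, P.Ans n)
    (k : Fin K) (ω : P.Outcome) : ∀ n, P.Ans n :=
  fun n => if n ∈ 𝓑 then attack (P.transmissions 𝓔 k ω) n else P.answer k n ω

variable [Fintype F]

/-- The joint law of `(κ, W, 𝒰, S)`: `κ` and the database are uniform, and the four components are
independent. -/
noncomputable def law (ω : P.Outcome) : ℝ :=
  (K : ℝ)⁻¹ * (Fintype.card (Fin K → P.File) : ℝ)⁻¹ * P.lawU ω.2.2.1 * P.lawS ω.2.2.2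

/-- Zero-error decodability: from the query scheme `𝒬`, the index `k` and the received answers the
user recovers `W_k` without error, whichever at most `B` answers are overwritten, by whatever. -/
def Decodable (B : ℕ) : Prop :=
  ∃ decode : (Fin K → ∀ n, P.Qry n) → Fin K → (∀ n, P.Ans n) → P.File,
    ∀ ω : P.Outcome, 0 < P.law ω → ∀ (k : Fin K) (𝓑 : Finset (Fin N)), 𝓑.card ≤ B →
      ∀ r : (∀ n, P.Ans n), (∀ n, n ∉ 𝓑 → r n = P.answer k n ω) →
        decode (P.queries ω) k r = P.files ω k

/-- User-privacy: `I(κ; Q_𝓣^[κ], A_𝓣^[κ], W_[1:K], S) = 0` for every set `𝓣` of `T` servers. -/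
def UserPrivate (T : ℕ) : Prop :=
  ∀ 𝓣 : Finset (Fin N), 𝓣.card = T →
    mutualInfo P.law P.index
      (fun ω => (P.transmissions 𝓣 (P.index ω) ω, P.files ω, P.commonRand ω)) = 0

/-- Database-privacy: `I(W_κ̄; A_[1:N]^[κ], 𝒬, κ) = 0`, where `A_[1:N]^[κ]` are the answers that reach
the user, under every attack by an adversary who taps in on at most `E` servers and overwrites the
answers of at most `B` servers (`𝓑 = ∅` is the case without corruption). -/
def DatabasePrivate (B E : ℕ) : Prop :=
  ∀ 𝓔 𝓑 : Finset (Fin N), 𝓔.card ≤ E → 𝓑.card ≤ B →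
    ∀ attack : (∀ n : 𝓔, P.Qry n × P.Ans n) → ∀ n, P.Ans n,
      mutualInfo P.law (fun ω => otherFiles (P.index ω) (P.files ω))
        (fun ω => (P.received 𝓔 𝓑 attack (P.index ω) ω, P.queries ω, P.index ω)) = 0

/-- Privacy against the eavesdropper: `I(W_[1:K]; Q_𝓔^[k], A_𝓔^[k]) = 0` for every set `𝓔` of at most
`E` servers and every `k`. -/
def EavesdropperPrivate (E : ℕ) : Prop :=
  ∀ 𝓔 : Finset (Fin N), 𝓔.card ≤ E → ∀ k : Fin K,
    mutualInfo P.law P.files (P.transmissions 𝓔 k) = 0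

/-- `P` is a T-BESPIR scheme: `T` colluding servers, `B` corrupted and `E` tapped servers. -/
structure IsTBESPIR (T B E : ℕ) : Prop where
  decodable : P.Decodable B
  userPrivate : P.UserPrivate T
  databasePrivate : P.DatabasePrivate B E
  eavesdropperPrivate : P.EavesdropperPrivate E

/-- The rate `H(W_k) / ∑ n, H(A_n^[k])`. -/
noncomputable def rate (k : Fin K) : ℝ :=
  entropy P.law (fun ω => P.files ω k) / ∑ n, entropy P.law (P.answer k n)

/-- The secrecy rate `H(S) / H(W_k)`. -/
noncomputable def secrecyRate (k : Fin K) : ℝ :=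
  entropy P.law P.commonRand / entropy P.law (fun ω => P.files ω k)

end Protocol

/-- The T-BESPIR capacity at secrecy rate `ρ`, for `K` files over `F` and `N` servers: the supremum
of the rates of all T-BESPIR schemes (with files of any length) whose secrecy rate is `ρ`, and `0` if
there is none. -/
noncomputable def capacityTBESPIR (N K : ℕ) (F : Type*) [Fintype F] (T B E : ℕ) (ρ : ℝ) : ℝ :=
  sSup {r : ℝ | ∃ P : Protocol N K F, P.IsTBESPIR T B E ∧
    ∀ k, P.secrecyRate k = ρ ∧ P.rate k = r}

/-! Put M = max(T, E) and fix a value u of the user's randomness with positive probability. For a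
desired index k the N answers then form a ramp secret sharing of W_k. Any N - 2B of them determine
W_k (`Decodable.determines`): two outcomes that agree there can be made to look alike by overwriting
at most B answers in each. Any M of them are independent of W_k (`IsTBESPIR.independent`): for E ≥ T
this is privacy against the eavesdropper; for T ≥ E user-privacy makes the queries look like a
request for another file, and database-privacy of that request hides W_k.

Rate bound: M answers say nothing about W_k, and N - 2B - M further ones complete its recovery, so
any N - 2B - M answers have total entropy at least H(W_k) (`entropy_le_sum_of_ramp`). Some set of
this size carries at most its proportional share of the total, and concavity of entropy averages the
bound over u.

Secrecy bound: database-privacy limits the joint entropy of the answers to H(W_k) + H(S)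
(`IsTBESPIR.jointEntropy_le`). By submodularity some M among N - 2B answers carry at least the share
M/(N - 2B) of their joint entropy, all of it independent of W_k (`mul_entropy_le_of_ramp`).

Achievability (`polyScheme`): over an extension field with at least N elements, the answers are the
values at N points of a polynomial with M + d = N - 2B coefficients. The M low ones are masked by
common randomness, the d high ones are the desired file. Each privacy condition follows from a
measure-preserving change of the hidden data that leaves the view unchanged
(`mutualInfo_eq_zero_of_symmetry`). Unused extra randomness raises the secrecy rate to exactly ρ. -/

/-! ### Entropy, independence and mutual information on finite probability spaces. -/

section Entropy

variable {Ω α β γ : Type*} [Fintype Ω] {p : Ω → ℝ}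

theorem marginal_nonneg (hp : ∀ ω, 0 ≤ p ω) (X : Ω → α) (a : α) : 0 ≤ marginal p X a :=
  Finset.sum_nonneg fun ω _ => by split_ifs <;> simp [hp ω]

theorem le_marginal (hp : ∀ ω, 0 ≤ p ω) (X : Ω → α) (ω : Ω) : p ω ≤ marginal p X (X ω) := by
  classical
  have := Finset.single_le_sum (f := fun ω' => if X ω' = X ω then p ω' else 0)
    (fun ω' _ => by split_ifs <;> simp [hp ω']) (Finset.mem_univ ω)
  simpa [marginal] using this

theorem exists_of_marginal_pos {X : Ω → α} {a : α} (h : 0 < marginal p X a) :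
    ∃ ω, X ω = a ∧ 0 < p ω := by
  obtain ⟨ω, -, hω⟩ := Finset.exists_lt_of_sum_lt (s := Finset.univ) (f := fun _ : Ω => (0 : ℝ))
    (by simpa [marginal] using h)
  by_cases hX : X ω = a
  · exact ⟨ω, hX, by simpa [hX] using hω⟩
  · simp [hX] at hω

theorem sum_marginal_mul [Fintype α] (X : Ω → α) (g : α → ℝ) :
    ∑ a, marginal p X a * g a = ∑ ω, p ω * g (X ω) := by
  classical
  simp only [marginal, Finset.sum_mul, ite_mul, zero_mul]
  rw [Finset.sum_comm]
  simp

theorem sum_marginal [Fintype α] (X : Ω → α) : ∑ a, marginal p X a = ∑ ω, p ω := by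
  simpa using sum_marginal_mul (p := p) X fun _ => 1

theorem marginal_comp [Fintype α] (X : Ω → α) (f : α → β) (b : β) :
    marginal p (fun ω => f (X ω)) b = marginal (marginal p X) f b := by
  classical
  have := sum_marginal_mul (p := p) X fun a => if f a = b then 1 else 0
  simpa [marginal] using this.symm

theorem marginal_congr {X : Ω → α} {Y : Ω → β} {a : α} {b : β}
    (h : ∀ ω, X ω = a ↔ Y ω = b) : marginal p X a = marginal p Y b := by
  classical
  exact Finset.sum_congr rfl fun ω _ => if_congr (h ω) rfl rfl

theorem sum_marginal_pair_right [Fintype β] (X : Ω → α) (Y : Ω → β) (a : α) :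
    ∑ b, marginal p (fun ω => (X ω, Y ω)) (a, b) = marginal p X a := by
  classical
  simp only [marginal, Prod.mk.injEq]
  rw [Finset.sum_comm]
  refine Finset.sum_congr rfl fun ω _ => ?_
  by_cases h : X ω = a <;> simp [h]

theorem sum_marginal_pair_left [Fintype α] (X : Ω → α) (Y : Ω → β) (b : β) :
    ∑ a, marginal p (fun ω => (X ω, Y ω)) (a, b) = marginal p Y b := by
  classical
  simp only [marginal, Prod.mk.injEq]
  rw [Finset.sum_comm]
  refine Finset.sum_congr rfl fun ω _ => ?_
  by_cases h : Y ω = b <;> simp [h]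

/-- Gibbs' inequality. -/
theorem sum_mul_log_le {ι : Type*} [Fintype ι] {f g : ι → ℝ} (hf : ∀ i, 0 ≤ f i)
    (hg : ∀ i, 0 ≤ g i) (hfg : ∀ i, g i = 0 → f i = 0) (h : ∑ i, g i ≤ ∑ i, f i) :
    ∑ i, f i * Real.log (g i) ≤ ∑ i, f i * Real.log (f i) := by
  have key : ∀ i, f i * Real.log (g i) + (f i - g i) ≤ f i * Real.log (f i) := fun i => by
    rcases (hf i).eq_or_lt with h0 | h0
    · simp [← h0, hg i]
    · have hgi : 0 < g i := (hg i).lt_of_ne fun h => h0.ne' (hfg i h.symm)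
      have := Real.log_le_sub_one_of_pos (div_pos hgi h0)
      rw [Real.log_div hgi.ne' h0.ne'] at this
      have h2 := mul_le_mul_of_nonneg_left this h0.le
      rw [mul_sub, mul_sub, mul_div_cancel₀ _ h0.ne'] at h2
      linarith
  have := Finset.sum_le_sum fun i (_ : i ∈ Finset.univ) => key i
  rw [Finset.sum_add_distrib, Finset.sum_sub_distrib] at this
  linarith

/-- The deficit in Gibbs' inequality is a sum of terms `g i * klFun (f i / g i)`; each is
nonnegative, and `klFun` vanishes only at 1. -/
theorem eq_of_sum_mul_log_eq {ι : Type*} [Fintype ι] {f g : ι → ℝ} (hf : ∀ i, 0 ≤ f i)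
    (hg : ∀ i, 0 ≤ g i) (hfg : ∀ i, g i = 0 → f i = 0) (h : ∑ i, g i = ∑ i, f i)
    (heq : ∑ i, f i * Real.log (g i) = ∑ i, f i * Real.log (f i)) (i : ι) : f i = g i := by
  have key : ∀ i, f i * Real.log (f i) - f i * Real.log (g i) - (f i - g i)
      = g i * InformationTheory.klFun (f i / g i) := fun i => by
    rcases (hg i).eq_or_lt with h0 | h0
    · simp [← h0, hfg i h0.symm]
    · rcases (hf i).eq_or_lt with h1 | h1
      · simp [← h1, InformationTheory.klFun]
      · rw [InformationTheory.klFun, Real.log_div h1.ne' h0.ne']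
        field_simp
        ring
  have hs : ∑ i, g i * InformationTheory.klFun (f i / g i) = 0 := by
    simp_rw [← key]
    simp only [Finset.sum_sub_distrib]
    linarith
  have hnn : ∀ i, 0 ≤ f i / g i := fun i => div_nonneg (hf i) (hg i)
  rw [Finset.sum_eq_zero_iff_of_nonneg fun i _ =>
    mul_nonneg (hg i) (InformationTheory.klFun_nonneg (hnn i))] at hs
  rcases mul_eq_zero.1 (hs i (Finset.mem_univ i)) with h0 | h0
  · rw [h0, hfg i h0]
  · rw [InformationTheory.klFun_eq_zero_iff (hnn i)] at h0
    have : g i ≠ 0 := fun h => by simp [h] at h0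
    field_simp at h0
    exact h0

/-- `H(X)` as the expectation of `-log p(X)`. -/
theorem entropy_eq_neg_sum [Fintype α] (X : Ω → α) :
    entropy p X = -∑ ω, p ω * Real.log (marginal p X (X ω)) := by
  rw [entropy, ← sum_marginal_mul X fun a => Real.log (marginal p X a), ← Finset.sum_neg_distrib]
  simp [Real.negMulLog]

/-- On the support of `p`, if `Y` determines `X` then `H(X) ≤ H(Y)`. -/
theorem entropy_le_of_determines [Fintype α] [Fintype β] (hp : ∀ ω, 0 ≤ p ω)
    {X : Ω → α} {Y : Ω → β}
    (h : ∀ ω ω', 0 < p ω → 0 < p ω' → Y ω = Y ω' → X ω = X ω') : entropy p X ≤ entropy p Y := by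
  classical
  rw [entropy_eq_neg_sum, entropy_eq_neg_sum, neg_le_neg_iff]
  refine Finset.sum_le_sum fun ω _ => ?_
  rcases (hp ω).eq_or_lt with h0 | h0
  · simp [← h0]
  refine mul_le_mul_of_nonneg_left (Real.log_le_log (h0.trans_le (le_marginal hp Y ω)) ?_) h0.le
  refine Finset.sum_le_sum fun ω' _ => ?_
  rcases (hp ω').eq_or_lt with h1 | h1
  · simp [← h1]
  by_cases hY : Y ω' = Y ω
  · simp [hY, h ω' ω h1 h0 hY]
  · simp only [hY, if_false]
    split_ifs <;> simp [h1.le]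

theorem entropy_congr [Fintype α] [Fintype β] (hp : ∀ ω, 0 ≤ p ω) {X : Ω → α} {Y : Ω → β}
    (h : ∀ ω ω', 0 < p ω → 0 < p ω' → (Y ω = Y ω' ↔ X ω = X ω')) : entropy p X = entropy p Y :=
  (entropy_le_of_determines hp fun ω ω' h0 h1 => (h ω ω' h0 h1).1).antisymm
    (entropy_le_of_determines hp fun ω ω' h0 h1 => (h ω ω' h0 h1).2)

theorem entropy_eq_zero_of_const [Fintype α] [Subsingleton α] (h1 : ∑ ω, p ω = 1) (X : Ω → α) :
    entropy p X = 0 := by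
  rw [entropy_eq_neg_sum]
  have : ∀ ω, marginal p X (X ω) = 1 := fun ω => by
    rw [← h1]
    exact Finset.sum_congr rfl fun ω' _ => if_pos (Subsingleton.elim _ _)
  simp [this]

/-- Submodularity: `H(X, Y, Z) + H(Z) ≤ H(X, Z) + H(Y, Z)`. -/
theorem entropy_submodular [Fintype α] [Fintype β] [Fintype γ] (hp : ∀ ω, 0 ≤ p ω)
    (X : Ω → α) (Y : Ω → β) (Z : Ω → γ) :
    entropy p (fun ω => (X ω, Y ω, Z ω)) + entropy p Z ≤
      entropy p (fun ω => (X ω, Z ω)) + entropy p (fun ω => (Y ω, Z ω)) := by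
  set m := marginal p (fun ω => (X ω, Y ω, Z ω)) with hm
  set mx := marginal p (fun ω => (X ω, Z ω)) with hmx
  set my := marginal p (fun ω => (Y ω, Z ω)) with hmy
  set mz := marginal p Z with hmz
  have hx : ∀ x z, ∑ y, m (x, y, z) = mx (x, z) := fun x z => by
    rw [hmx, ← sum_marginal_pair_right (fun ω => (X ω, Z ω)) Y]
    exact Finset.sum_congr rfl fun y _ => marginal_congr fun ω => by simp; tauto
  have hy : ∀ y z, ∑ x, m (x, y, z) = my (y, z) := fun y z =>
    sum_marginal_pair_left X (fun ω => (Y ω, Z ω)) (y, z)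
  have hxz : ∀ z, ∑ x, mx (x, z) = mz z := sum_marginal_pair_left X Z
  have hyz : ∀ z, ∑ y, my (y, z) = mz z := sum_marginal_pair_left Y Z
  have n0 : ∀ t, 0 ≤ m t := marginal_nonneg hp _
  have nx : ∀ t, 0 ≤ mx t := marginal_nonneg hp _
  have ny : ∀ t, 0 ≤ my t := marginal_nonneg hp _
  have nz : ∀ t, 0 ≤ mz t := marginal_nonneg hp _
  have lx : ∀ x y z, m (x, y, z) ≤ mx (x, z) := fun x y z => by
    rw [← hx]; exact Finset.single_le_sum (f := fun y => m (x, y, z)) (fun _ _ => n0 _) (Finset.mem_univ y)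
  have ly : ∀ x y z, m (x, y, z) ≤ my (y, z) := fun x y z => by
    rw [← hy]; exact Finset.single_le_sum (f := fun x => m (x, y, z)) (fun _ _ => n0 _) (Finset.mem_univ x)
  have lz : ∀ x z, mx (x, z) ≤ mz z := fun x z => by
    rw [← hxz]; exact Finset.single_le_sum (f := fun x => mx (x, z)) (fun _ _ => nx _) (Finset.mem_univ x)
  -- The comparison law makes X and Y conditionally independent given Z, with the same pair
  -- marginals (X, Z) and (Y, Z).
  have gibbs := sum_mul_log_le (f := m)
    (g := fun t => mx (t.1, t.2.2) * my (t.2.1, t.2.2) / mz t.2.2) n0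
    (fun t => div_nonneg (mul_nonneg (nx _) (ny _)) (nz _))
    (fun ⟨x, y, z⟩ h => by
      refine le_antisymm ?_ (n0 _)
      rcases div_eq_zero_iff.1 h with h | h
      · rcases mul_eq_zero.1 h with h | h
        · exact h ▸ lx x y z
        · exact h ▸ ly x y z
      · exact h ▸ (lx x y z).trans (lz x z))
    (by
      refine le_of_eq ?_
      rw [hm, sum_marginal, ← sum_marginal (p := p) Z, Fintype.sum_prod_type]
      simp_rw [Fintype.sum_prod_type]
      have : ∀ x, ∑ y, ∑ z, mx (x, z) * my (y, z) / mz z = ∑ z, mx (x, z) * mz z / mz z := fun x => by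
        rw [Finset.sum_comm]
        refine Finset.sum_congr rfl fun z _ => ?_
        rw [← Finset.sum_div, ← Finset.mul_sum, hyz]
      simp_rw [this]
      rw [Finset.sum_comm]
      refine Finset.sum_congr rfl fun z _ => ?_
      rw [← Finset.sum_div, ← Finset.sum_mul, hxz, mul_self_div_self])
  rw [sum_marginal_mul, sum_marginal_mul] at gibbs
  simp only [entropy_eq_neg_sum]
  have : ∑ ω, p ω * Real.log (mx (X ω, Z ω) * my (Y ω, Z ω) / mz (Z ω)) =
      ∑ ω, p ω * Real.log (mx (X ω, Z ω)) + ∑ ω, p ω * Real.log (my (Y ω, Z ω)) -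
        ∑ ω, p ω * Real.log (mz (Z ω)) := by
    rw [← Finset.sum_add_distrib, ← Finset.sum_sub_distrib]
    refine Finset.sum_congr rfl fun ω _ => ?_
    rcases (hp ω).eq_or_lt with h0 | h0
    · simp [← h0]
    have h1 := h0.trans_le (le_marginal hp (fun ω => (X ω, Z ω)) ω)
    have h2 := h0.trans_le (le_marginal hp (fun ω => (Y ω, Z ω)) ω)
    have h3 := h0.trans_le (le_marginal hp Z ω)
    rw [Real.log_div (mul_pos h1 h2).ne' h3.ne', Real.log_mul h1.ne' h2.ne']
    ring
  linarith

/-- Subadditivity of entropy. -/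
theorem entropy_pair_le [Fintype α] [Fintype β] (hp : ∀ ω, 0 ≤ p ω) (h1 : ∑ ω, p ω = 1)
    (X : Ω → α) (Y : Ω → β) :
    entropy p (fun ω => (X ω, Y ω)) ≤ entropy p X + entropy p Y := by
  have h := entropy_submodular hp X Y fun _ => ()
  rw [entropy_eq_zero_of_const h1 fun _ => (),
    entropy_congr hp (X := fun ω => (X ω, Y ω, ())) (Y := fun ω => (X ω, Y ω)) (by simp),
    entropy_congr hp (X := fun ω => (X ω, ())) (Y := X) (by simp),
    entropy_congr hp (X := fun ω => (Y ω, ())) (Y := Y) (by simp)] at h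
  linarith

theorem entropy_le_log_card [Fintype α] (hp : ∀ ω, 0 ≤ p ω) (h1 : ∑ ω, p ω = 1) (X : Ω → α) :
    entropy p X ≤ Real.log (Fintype.card α) := by
  have hne : Nonempty α := by
    obtain ⟨ω, -⟩ : ∃ ω : Ω, p ω ≠ 0 := by
      by_contra! h
      simp [h] at h1
    exact ⟨X ω⟩
  have hc : (Fintype.card α : ℝ) ≠ 0 := by simp
  have := sum_mul_log_le (f := marginal p X) (g := fun _ => (Fintype.card α : ℝ)⁻¹)
    (marginal_nonneg hp X) (fun _ => by positivity) (fun _ h => absurd h (by simp))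
    (by rw [sum_marginal, h1]; simp)
  rw [← Finset.sum_mul, sum_marginal, h1, Real.log_inv] at this
  simp only [entropy, Real.negMulLog, neg_mul, Finset.sum_neg_distrib]
  linarith

theorem entropy_eq_log_card [Fintype α] [Nonempty α] {X : Ω → α}
    (h : ∀ a, marginal p X a = (Fintype.card α : ℝ)⁻¹) :
    entropy p X = Real.log (Fintype.card α) := by
  simp [entropy, h, Real.negMulLog]

/-- Independence of two random variables. -/
def Independent (p : Ω → ℝ) (X : Ω → α) (Y : Ω → β) : Prop :=
  ∀ a b, marginal p (fun ω => (X ω, Y ω)) (a, b) = marginal p X a * marginal p Y b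

/-- Mutual information is the relative entropy of the joint law with respect to the product of the
marginals, so this is the equality case of Gibbs' inequality. -/
theorem mutualInfo_eq_zero_iff [Fintype α] [Fintype β] (hp : ∀ ω, 0 ≤ p ω) (h1 : ∑ ω, p ω = 1)
    (X : Ω → α) (Y : Ω → β) : mutualInfo p X Y = 0 ↔ Independent p X Y := by
  have hlog : ∑ t : α × β, marginal p (fun ω => (X ω, Y ω)) t *
      Real.log (marginal p X t.1 * marginal p Y t.2) = -(entropy p X + entropy p Y) := by
    rw [sum_marginal_mul, entropy_eq_neg_sum, entropy_eq_neg_sum, ← neg_add, neg_neg,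
      ← Finset.sum_add_distrib]
    refine Finset.sum_congr rfl fun ω _ => ?_
    rcases (hp ω).eq_or_lt with h0 | h0
    · simp [← h0]
    rw [Real.log_mul (h0.trans_le (le_marginal hp X ω)).ne'
      (h0.trans_le (le_marginal hp Y ω)).ne', mul_add]
  have hxy : ∑ t : α × β, marginal p (fun ω => (X ω, Y ω)) t *
      Real.log (marginal p (fun ω => (X ω, Y ω)) t) = -entropy p (fun ω => (X ω, Y ω)) := by
    simp [entropy, Real.negMulLog]
  constructor
  · intro h a b
    refine eq_of_sum_mul_log_eq (f := marginal p (fun ω => (X ω, Y ω)))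
      (g := fun t => marginal p X t.1 * marginal p Y t.2) (marginal_nonneg hp _)
      (fun t => mul_nonneg (marginal_nonneg hp _ _) (marginal_nonneg hp _ _)) ?_ ?_ ?_ (a, b)
    · rintro ⟨a, b⟩ h
      refine le_antisymm ?_ (marginal_nonneg hp _ _)
      rcases mul_eq_zero.1 h with h | h
      · rw [← h, ← sum_marginal_pair_right X Y]
        exact Finset.single_le_sum (f := fun b => marginal p (fun ω => (X ω, Y ω)) (a, b))
          (fun _ _ => marginal_nonneg hp _ _) (Finset.mem_univ b)
      · rw [← h, ← sum_marginal_pair_left X Y]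
        exact Finset.single_le_sum (f := fun a => marginal p (fun ω => (X ω, Y ω)) (a, b))
          (fun _ _ => marginal_nonneg hp _ _) (Finset.mem_univ a)
    · rw [Fintype.sum_prod_type, sum_marginal, h1]
      simp_rw [← Finset.mul_sum, sum_marginal, h1, mul_one]
      rw [sum_marginal, h1]
    · rw [hlog, hxy]
      unfold mutualInfo at h
      linarith
  · intro h
    have : ∑ t : α × β, marginal p (fun ω => (X ω, Y ω)) t *
        Real.log (marginal p X t.1 * marginal p Y t.2) = ∑ t : α × β,
        marginal p (fun ω => (X ω, Y ω)) t * Real.log (marginal p (fun ω => (X ω, Y ω)) t) :=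
      Finset.sum_congr rfl fun t _ => by rw [← h t.1 t.2]
    unfold mutualInfo
    linarith

theorem Independent.entropy_pair [Fintype α] [Fintype β] (hp : ∀ ω, 0 ≤ p ω) (h1 : ∑ ω, p ω = 1)
    {X : Ω → α} {Y : Ω → β} (h : Independent p X Y) :
    entropy p (fun ω => (X ω, Y ω)) = entropy p X + entropy p Y := by
  have := (mutualInfo_eq_zero_iff hp h1 X Y).2 h
  unfold mutualInfo at this
  linarith

theorem Independent.comp {α' β' : Type*} [Fintype α] [Fintype β] {X : Ω → α} {Y : Ω → β}
    (h : Independent p X Y) (f : α → α') (g : β → β') :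
    Independent p (fun ω => f (X ω)) (fun ω => g (Y ω)) := by
  classical
  intro a b
  rw [marginal_comp X f, marginal_comp Y g,
    marginal_comp (fun ω => (X ω, Y ω)) (fun t => (f t.1, g t.2))]
  simp only [marginal]
  rw [Finset.sum_mul_sum, Fintype.sum_prod_type]
  refine Finset.sum_congr rfl fun x _ => Finset.sum_congr rfl fun y _ => ?_
  have := h x y
  simp only [marginal] at this
  by_cases hx : f x = a <;> by_cases hy : g y = b <;> simp [hx, hy, ← this]

/-- Independence passes to a law that is, up to scaling, a restriction of the given one. -/
theorem Independent.of_scaled {Ω' β' : Type*} [Fintype Ω'] [Fintype α] [Fintype β']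
    {p' : Ω' → ℝ} (h1 : ∑ ω, p' ω = 1) {X : Ω → α} {Y : Ω → β} (h : Independent p X Y)
    {X' : Ω' → α} {Y' : Ω' → β'} (ι : β' → β) {c : ℝ} (hc : c ≠ 0)
    (hs : ∀ a b, marginal p (fun ω => (X ω, Y ω)) (a, ι b) =
      c * marginal p' (fun ω => (X' ω, Y' ω)) (a, b)) : Independent p' X' Y' := by
  have hY : ∀ b, marginal p Y (ι b) = c * marginal p' Y' b := fun b => by
    rw [← sum_marginal_pair_left X Y, ← sum_marginal_pair_left X' Y', Finset.mul_sum]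
    exact Finset.sum_congr rfl fun a _ => hs a b
  -- Cancelling c gives a factorization with the law of X as a factor; summing over b identifies it
  -- with the law of X'.
  have key : ∀ a b, marginal p' (fun ω => (X' ω, Y' ω)) (a, b) =
      marginal p X a * marginal p' Y' b := fun a b => by
    have := hs a b
    rw [h, hY] at this
    refine mul_left_cancel₀ hc ?_
    rw [← this]
    ring
  have hX : ∀ a, marginal p' X' a = marginal p X a := fun a => by
    rw [← sum_marginal_pair_right X' Y']
    simp_rw [key]
    rw [← Finset.mul_sum, sum_marginal, h1, mul_one]
  intro a b
  rw [key, hX]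

/-- If the fibres of `X` can be carried into each other injectively, preserving `p` and `Y`, then
`X` and `Y` are independent. -/
theorem mutualInfo_eq_zero_of_symmetry [Fintype α] [Fintype β] (hp : ∀ ω, 0 ≤ p ω)
    (h1 : ∑ ω, p ω = 1) {X : Ω → α} {Y : Ω → β}
    (h : ∀ x x', ∃ τ : Ω → Ω, Set.InjOn τ {ω | X ω = x} ∧
      ∀ ω, X ω = x → p (τ ω) = p ω ∧ X (τ ω) = x' ∧ Y (τ ω) = Y ω) : mutualInfo p X Y = 0 := by
  classical
  rw [mutualInfo_eq_zero_iff hp h1]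
  -- An injection gives only an inequality, but x and x' are arbitrary. Hence the joint mass does
  -- not depend on x, and X is uniform.
  have le : ∀ x x' y, marginal p (fun ω => (X ω, Y ω)) (x, y) ≤
      marginal p (fun ω => (X ω, Y ω)) (x', y) := fun x x' y => by
    obtain ⟨τ, hτ, hτ'⟩ := h x x'
    simp only [marginal, Prod.mk.injEq, ← Finset.sum_filter]
    rw [← Finset.sum_congr rfl fun ω hω => (hτ' ω (Finset.mem_filter.1 hω).2.1).1,
      ← Finset.sum_image (f := p) (g := τ) fun ω hω ω' hω' => hτ
        (Finset.mem_filter.1 hω).2.1 (Finset.mem_filter.1 hω').2.1]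
    refine Finset.sum_le_sum_of_subset_of_nonneg ?_ fun _ _ _ => hp _
    intro ω' hω'
    obtain ⟨ω, hω, rfl⟩ := Finset.mem_image.1 hω'
    obtain ⟨-, hx, hy⟩ := Finset.mem_filter.1 hω
    simp [(hτ' ω hx).2, hy]
  intro a b
  have hX : ∀ x x', marginal p X x = marginal p X x' := fun x x' => by
    simp_rw [← sum_marginal_pair_right X Y]
    exact Finset.sum_congr rfl fun y _ => (le x x' y).antisymm (le x' x y)
  have hn : (Fintype.card α : ℝ) * marginal p X a = 1 := by
    rw [← h1, ← sum_marginal X, Finset.sum_congr rfl fun x _ => hX x a]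
    simp
  have hY : marginal p Y b =
      (Fintype.card α : ℝ) * marginal p (fun ω => (X ω, Y ω)) (a, b) := by
    rw [← sum_marginal_pair_left X Y,
      Finset.sum_congr rfl fun x _ => (le x a b).antisymm (le a x b)]
    simp
  rw [hY]
  linear_combination (-marginal p (fun ω => (X ω, Y ω)) (a, b)) * hn

/-- Concavity of entropy: conditioning does not increase it. -/
theorem sum_mul_entropy_le [Fintype α] {Υ : Type*} [Fintype Υ] {c : Υ → ℝ} (hc : ∀ u, 0 ≤ c u)
    (hc1 : ∑ u, c u = 1) {Ω' : Type*} [Fintype Ω'] {p' : Ω' → ℝ} (hp' : ∀ ω, 0 ≤ p' ω)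
    {X : Ω → α} {X' : Υ → Ω' → α}
    (h : ∀ a, marginal p X a = ∑ u, c u * marginal p' (X' u) a) :
    ∑ u, c u * entropy p' (X' u) ≤ entropy p X := by
  simp only [entropy, Finset.mul_sum]
  rw [Finset.sum_comm]
  refine Finset.sum_le_sum fun a _ => ?_
  rw [h]
  exact Real.concaveOn_negMulLog.le_map_sum (fun u _ => hc u) hc1
    fun u _ => Set.mem_Ici.2 (marginal_nonneg hp' _ _)

end Entropy

/-! ### Greedy selection of subsets with a proportional share. -/

section Greedy

/-- A set function whose marginal gains add up to at least the total gain admits, in every size,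
a subset with at least its proportional share. -/
theorem exists_subset_proportional {ι : Type*} [DecidableEq ι] {f : Finset ι → ℝ} {C : Finset ι}
    (h0 : 0 ≤ f ∅)
    (h : ∀ X ⊆ C, f C - f X ≤ ∑ i ∈ C \ X, (f (insert i X) - f X)) :
    ∀ t ≤ C.card, ∃ X ⊆ C, X.card = t ∧ t * f C ≤ C.card * f X := by
  intro t
  induction t with
  | zero => exact fun _ => ⟨∅, by simp, by simp, by simpa using by positivity⟩
  | succ t ih =>
    intro ht
    obtain ⟨X, hXC, hXt, hX⟩ := ih (by omega)
    have hcard : (C \ X).card = C.card - t := by rw [Finset.card_sdiff_of_subset hXC, hXt]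
    have hne : (C \ X).Nonempty := Finset.card_pos.1 (by omega)
    have hr : (0 : ℝ) < C.card - t := by
      have : (t : ℝ) + 1 ≤ C.card := by exact_mod_cast ht
      linarith
    have hr1 : (0 : ℝ) ≤ C.card - t - 1 := by
      have : (t : ℝ) + 1 ≤ C.card := by exact_mod_cast ht
      linarith
    have hcR : ((C \ X).card : ℝ) = C.card - t := by
      rw [hcard, Nat.cast_sub (by omega)]
    -- Some element gains at least the average of the missing amount over the `C.card - t` elements
    -- left.
    obtain ⟨i, hi, hgain⟩ := Finset.exists_le_of_sum_le hne
      (f := fun _ => (f C - f X) / (C.card - t)) (g := fun i => f (insert i X) - f X) (by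
        rw [Finset.sum_const, nsmul_eq_mul, hcR, mul_div_cancel₀ _ hr.ne']
        exact h X hXC)
    rw [Finset.mem_sdiff] at hi
    refine ⟨insert i X, Finset.insert_subset hi.1 hXC, by rw [Finset.card_insert_of_notMem hi.2, hXt], ?_⟩
    rw [div_le_iff₀ hr] at hgain
    -- With the denominator `C.card - t` cleared, the claim is `C.card - t - 1` times the induction
    -- hypothesis plus `C.card` times the gain.
    refine le_of_mul_le_mul_right ?_ hr
    have h1 := mul_le_mul_of_nonneg_left hX hr1
    have h2 := mul_le_mul_of_nonneg_left hgain (Nat.cast_nonneg (α := ℝ) C.card)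
    push_cast
    nlinarith

/-- The greedy choice applied to minus the sum yields a D whose sum is at most its proportional
share, and already this D gives the bound. -/
theorem card_mul_le_of_forall_sum {ι : Type*} [Fintype ι] {x : ι → ℝ} {l : ℝ} {d : ℕ}
    (hd : d ≤ Fintype.card ι) (h : ∀ D : Finset ι, D.card = d → l ≤ ∑ i ∈ D, x i) :
    Fintype.card ι * l ≤ d * ∑ i, x i := by
  classical
  obtain ⟨D, -, hD, hle⟩ := exists_subset_proportional (f := fun X => -∑ i ∈ X, x i)
    (C := Finset.univ) (by simp) (fun X _ => by
      have hgain : ∀ i ∈ Finset.univ \ X, (-∑ j ∈ insert i X, x j - -∑ j ∈ X, x j) = -x i :=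
        fun i hi => by rw [Finset.sum_insert (Finset.mem_sdiff.1 hi).2]; ring
      rw [Finset.sum_congr rfl hgain, ← Finset.sum_sdiff (Finset.subset_univ X),
        Finset.sum_neg_distrib]
      linarith) d hd
  have := mul_le_mul_of_nonneg_left (h D hD) (Nat.cast_nonneg (α := ℝ) (Fintype.card ι))
  rw [Finset.card_univ] at hle
  linarith

end Greedy

/-! ### Joint entropies of families, and ramp secret sharing. -/

section JointEntropy

variable {Ω ι β : Type*} {α : ι → Type*}

/-- The subfamily of `A` indexed by `s`, as one random variable. -/
def subfamily (A : ∀ i, Ω → α i) (s : Finset ι) (ω : Ω) : ∀ i : s, α i := fun i => A i ω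

theorem subfamily_eq_iff {A : ∀ i, Ω → α i} {s : Finset ι} {ω ω' : Ω} :
    subfamily A s ω = subfamily A s ω' ↔ ∀ i ∈ s, A i ω = A i ω' := by
  simp [subfamily, funext_iff]

variable [Fintype Ω] [∀ i, Fintype (α i)] [Fintype β] [DecidableEq ι] {p : Ω → ℝ}

/-- The joint entropy of the subfamily of `A` indexed by `s`. -/
noncomputable def jointEntropy (p : Ω → ℝ) (A : ∀ i, Ω → α i) (s : Finset ι) : ℝ :=
  entropy p (subfamily A s)

variable (hp : ∀ ω, 0 ≤ p ω) (h1 : ∑ ω, p ω = 1) (A : ∀ i, Ω → α i)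

include h1 in
theorem jointEntropy_empty : jointEntropy p A ∅ = 0 := entropy_eq_zero_of_const h1 _

include hp

/-- The chain rule with all conditioning beyond X dropped, by submodularity. For `Y = C \ X` it is
the hypothesis of `exists_subset_proportional`. -/
theorem jointEntropy_union_sub_le (X Y : Finset ι) :
    jointEntropy p A (X ∪ Y) - jointEntropy p A X ≤
      ∑ i ∈ Y, (jointEntropy p A (insert i X) - jointEntropy p A X) := by
  induction Y using Finset.induction_on with
  | empty => simp
  | insert i Y hi ih =>
    rw [Finset.sum_insert hi]
    have h := entropy_submodular hp (A i) (subfamily A Y) (subfamily A X)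
    rw [entropy_congr hp (X := fun ω => (A i ω, subfamily A Y ω, subfamily A X ω))
        (Y := subfamily A (X ∪ insert i Y)) (fun ω ω' _ _ => by
          simp only [subfamily_eq_iff, Prod.mk.injEq, Finset.mem_union, Finset.mem_insert]
          grind),
      entropy_congr hp (X := fun ω => (A i ω, subfamily A X ω))
        (Y := subfamily A (insert i X)) (fun ω ω' _ _ => by
          simp only [subfamily_eq_iff, Prod.mk.injEq, Finset.mem_insert]
          grind),
      entropy_congr hp (X := fun ω => (subfamily A Y ω, subfamily A X ω))
        (Y := subfamily A (X ∪ Y)) (fun ω ω' _ _ => by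
          simp only [subfamily_eq_iff, Prod.mk.injEq, Finset.mem_union]
          grind)] at h
    unfold jointEntropy at ih ⊢
    linarith

include h1

theorem jointEntropy_insert_le (i : ι) (X : Finset ι) :
    jointEntropy p A (insert i X) ≤ jointEntropy p A X + entropy p (A i) := by
  have h := entropy_pair_le hp h1 (A i) (subfamily A X)
  rw [entropy_congr hp (X := fun ω => (A i ω, subfamily A X ω))
    (Y := subfamily A (insert i X)) (fun ω ω' _ _ => by
      simp only [subfamily_eq_iff, Prod.mk.injEq, Finset.mem_insert]
      grind)] at h
  unfold jointEntropy
  linarith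

theorem exists_subset_jointEntropy (C : Finset ι) (t : ℕ) (ht : t ≤ C.card) :
    ∃ X ⊆ C, X.card = t ∧ t * jointEntropy p A C ≤ C.card * jointEntropy p A X :=
  exists_subset_proportional (jointEntropy_empty h1 A).ge
    (fun X hX => by
      have := jointEntropy_union_sub_le hp A X (C \ X)
      rwa [Finset.union_sdiff_of_subset hX] at this) t ht

variable {A} {V : Ω → β} {X C : Finset ι}

/-- The shares in C determine both V and the shares in X, and these two are independent. -/
theorem entropy_add_jointEntropy_le (hind : Independent p V (subfamily A X)) (hXC : X ⊆ C)
    (hdet : ∀ ω ω', 0 < p ω → 0 < p ω' → (∀ i ∈ C, A i ω = A i ω') → V ω = V ω') :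
    entropy p V + jointEntropy p A X ≤ jointEntropy p A C := by
  unfold jointEntropy
  rw [← hind.entropy_pair hp h1]
  refine entropy_le_of_determines hp fun ω ω' h h' heq => ?_
  rw [subfamily_eq_iff] at heq
  simp only [Prod.mk.injEq, subfamily_eq_iff]
  exact ⟨hdet ω ω' h h' heq, fun i hi => heq i (hXC hi)⟩

variable {n M : ℕ}

/-- Ramp secret sharing: if any `M` shares are independent of the secret and any `n` shares determine
it, then any `n - M` shares have total entropy at least that of the secret. -/
theorem entropy_le_sum_of_ramp [Fintype ι] (hMn : M ≤ n) (hn : n ≤ Fintype.card ι)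
    (hind : ∀ X : Finset ι, X.card = M → Independent p V (subfamily A X))
    (hdet : ∀ C : Finset ι, C.card = n → ∀ ω ω', 0 < p ω → 0 < p ω' →
      (∀ i ∈ C, A i ω = A i ω') → V ω = V ω')
    (D : Finset ι) (hD : D.card = n - M) : entropy p V ≤ ∑ i ∈ D, entropy p (A i) := by
  obtain ⟨X, hXD, hX⟩ := Finset.exists_subset_card_eq (s := Dᶜ) (n := M)
    (by rw [Finset.card_compl]; omega)
  have hdisj : Disjoint X D := Finset.disjoint_left.2 fun i hi => Finset.mem_compl.1 (hXD hi)
  have h2 := entropy_add_jointEntropy_le hp h1 (hind X hX) (Finset.subset_union_left (s₂ := D))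
    (hdet _ (by rw [Finset.card_union_of_disjoint hdisj]; omega))
  have h3 := jointEntropy_union_sub_le hp A X D
  have h4 : ∑ i ∈ D, (jointEntropy p A (insert i X) - jointEntropy p A X) ≤
      ∑ i ∈ D, entropy p (A i) := Finset.sum_le_sum fun i _ => by
    linarith [jointEntropy_insert_le hp h1 A i X]
  linarith

/-- Ramp secret sharing: if the entropy of `n` shares exceeds that of the secret by at most `σ`, then
`σ` is at least the proportional share `M / (n - M)` of the entropy of the secret. -/
theorem mul_entropy_le_of_ramp (hMn : M ≤ n) (hC : C.card = n)
    (hind : ∀ X : Finset ι, X.card = M → Independent p V (subfamily A X))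
    (hdet : ∀ ω ω', 0 < p ω → 0 < p ω' → (∀ i ∈ C, A i ω = A i ω') → V ω = V ω')
    {σ : ℝ} (hσ : jointEntropy p A C ≤ entropy p V + σ) :
    M * entropy p V ≤ (n - M) * σ := by
  -- These M shares have at least the fraction M / n of the joint entropy of C, which leaves at most
  -- the fraction (n - M) / n for the secret.
  obtain ⟨X, hXC, hX, hle⟩ := exists_subset_jointEntropy hp h1 A C M (by omega)
  have h2 := entropy_add_jointEntropy_le hp h1 (hind X hX) hXC hdet
  rw [hC] at hle
  have hMR : (M : ℝ) ≤ n := by exact_mod_cast hMn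
  have h3 := mul_le_mul_of_nonneg_left h2 (Nat.cast_nonneg (α := ℝ) n)
  have h4 := mul_le_mul_of_nonneg_left hσ (sub_nonneg.2 hMR)
  linarith

end JointEntropy

/-! ### Protocols conditioned on the index and the user's randomness. -/

theorem card_mul_marginal_eval {K : ℕ} {α : Type*} [Fintype α] (c : ℝ) (k : Fin K) (a : α) :
    Fintype.card α * marginal (fun _ : Fin K → α => c) (fun w => w k) a =
      Fintype.card (Fin K → α) * c := by
  classical
  have h : ∀ b, marginal (fun _ : Fin K → α => c) (fun w => w k) b =
      Fintype.card ({j // j ≠ k} → α) * c := fun b => by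
    simp only [marginal]
    rw [← (Equiv.funSplitAt k α).symm.sum_comp, Fintype.sum_prod_type]
    simp [Equiv.funSplitAt, Equiv.piSplitAt]
  rw [h, Fintype.card_congr (Equiv.funSplitAt k α), Fintype.card_prod]
  push_cast
  ring

namespace Protocol

variable {N K : ℕ} {F : Type*} (P : Protocol N K F)

/-- The answer of server `n` to the query determined by `u`, as a function of database and common
randomness. -/
def answerTo (u : P.U) (k : Fin K) (n : Fin N) (t : (Fin K → P.File) × P.S) : P.Ans n :=
  P.respond n (P.query u k n) t.1 (P.nodeRand n t.2)

theorem lawU_nonneg (u : P.U) : 0 ≤ P.lawU u := P.lawU.2.1 u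
theorem lawS_nonneg (s : P.S) : 0 ≤ P.lawS s := P.lawS.2.1 s
theorem sum_lawU : ∑ u, P.lawU u = 1 := P.lawU.2.2
theorem sum_lawS : ∑ s, P.lawS s = 1 := P.lawS.2.2

theorem sum_weights [NeZero K] : ∑ _k : Fin K, ∑ u, (K : ℝ)⁻¹ * P.lawU u = 1 := by
  simp [← Finset.mul_sum, NeZero.ne K]

theorem exists_lawU_pos : ∃ u, 0 < P.lawU u := by
  by_contra! h
  have := P.sum_lawU
  rw [Finset.sum_eq_zero fun u _ => (h u).antisymm (P.lawU_nonneg u)] at this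
  simp at this

theorem exists_lawS_pos : ∃ s, 0 < P.lawS s := by
  by_contra! h
  have := P.sum_lawS
  rw [Finset.sum_eq_zero fun u _ => (h u).antisymm (P.lawS_nonneg u)] at this
  simp at this

variable [Fintype F]

/-- The joint law of the database and the common randomness. -/
noncomputable def serverLaw (t : (Fin K → P.File) × P.S) : ℝ :=
  (Fintype.card (Fin K → P.File) : ℝ)⁻¹ * P.lawS t.2

theorem serverLaw_nonneg (t : (Fin K → P.File) × P.S) : 0 ≤ P.serverLaw t :=
  mul_nonneg (by positivity) (P.lawS_nonneg _)

theorem law_eq (k : Fin K) (w : Fin K → P.File) (u : P.U) (s : P.S) :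
    P.law (k, w, u, s) = (K : ℝ)⁻¹ * P.lawU u * P.serverLaw (w, s) := by
  simp only [law, serverLaw]
  ring

theorem law_nonneg (ω : P.Outcome) : 0 ≤ P.law ω := by
  obtain ⟨k, w, u, s⟩ := ω
  rw [law_eq]
  exact mul_nonneg (mul_nonneg (by positivity) (P.lawU_nonneg u)) (P.serverLaw_nonneg _)

theorem sum_outcome (g : P.Outcome → ℝ) :
    ∑ ω, g ω = ∑ k, ∑ u, ∑ t : (Fin K → P.File) × P.S, g (k, t.1, u, t.2) := by
  simp only [Fintype.sum_prod_type]
  refine Finset.sum_congr rfl fun k _ => ?_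
  rw [Finset.sum_comm]

/-- For fixed index and user randomness everything is a function of database and common randomness,
so the law is a mixture of copies of `serverLaw`. -/
theorem marginal_law {α : Type*} (X : P.Outcome → α) (a : α) : marginal P.law X a =
    ∑ k, ∑ u, (K : ℝ)⁻¹ * P.lawU u *
      marginal P.serverLaw (fun t => X (k, t.1, u, t.2)) a := by
  rw [marginal, sum_outcome]
  refine Finset.sum_congr rfl fun k _ => Finset.sum_congr rfl fun u _ => ?_
  rw [marginal, Finset.mul_sum]
  refine Finset.sum_congr rfl fun t _ => ?_
  rw [law_eq, mul_ite, mul_zero]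

theorem marginal_law_of_server [NeZero K] {α : Type*} {X : (Fin K → P.File) × P.S → α} (a : α) :
    marginal P.law (fun ω => X (ω.2.1, ω.2.2.2)) a = marginal P.serverLaw X a := by
  rw [marginal_law]
  simp only [← Finset.sum_mul]
  rw [sum_weights, one_mul]

theorem entropy_law_of_server [NeZero K] {α : Type*} [Fintype α]
    (X : (Fin K → P.File) × P.S → α) :
    entropy P.law (fun ω => X (ω.2.1, ω.2.2.2)) = entropy P.serverLaw X := by
  simp only [entropy, marginal_law_of_server]

section Nonempty

variable [Nonempty F]

theorem sum_serverLaw : ∑ t, P.serverLaw t = 1 := by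
  simp [serverLaw, Fintype.sum_prod_type, ← Finset.mul_sum]

theorem sum_law [NeZero K] : ∑ ω, P.law ω = 1 := by
  rw [sum_outcome]
  simp only [law_eq, Prod.mk.eta, ← Finset.mul_sum]
  simp [← Finset.mul_sum, sum_serverLaw, NeZero.ne K]

theorem law_pos_iff [NeZero K] {k : Fin K} {w : Fin K → P.File} {u : P.U} {s : P.S} :
    0 < P.law (k, w, u, s) ↔ 0 < P.lawU u ∧ 0 < P.lawS s := by
  have hc : (0 : ℝ) < Fintype.card (Fin K → P.File) := by exact_mod_cast Fintype.card_pos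
  have hK : (0 : ℝ) < K := by exact_mod_cast NeZero.pos K
  have h1 := P.lawU_nonneg u
  have h2 := P.lawS_nonneg s
  constructor
  · intro h
    refine ⟨h1.lt_of_ne fun h0 => ?_, h2.lt_of_ne fun h0 => ?_⟩ <;> simp [law, ← h0] at h
  · rintro ⟨h3, h4⟩
    unfold law
    positivity

theorem serverLaw_pos_iff {t : (Fin K → P.File) × P.S} : 0 < P.serverLaw t ↔ 0 < P.lawS t.2 := by
  have hc : (0 : ℝ) < Fintype.card (Fin K → P.File) := by exact_mod_cast Fintype.card_pos
  rw [serverLaw]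
  exact mul_pos_iff_of_pos_left (inv_pos.2 hc)

theorem entropy_file_server (k : Fin K) :
    entropy P.serverLaw (fun t => t.1 k) = Real.log (Fintype.card P.File) := by
  refine entropy_eq_log_card fun a => ?_
  have hfst : marginal P.serverLaw Prod.fst =
      fun _ => (Fintype.card (Fin K → P.File) : ℝ)⁻¹ := by
    funext w
    classical
    simp only [marginal, serverLaw, Fintype.sum_prod_type]
    rw [Finset.sum_comm]
    simp [← Finset.mul_sum]
  have hc : (Fintype.card P.File : ℝ) ≠ 0 := by exact_mod_cast Fintype.card_ne_zero
  have hc' : (Fintype.card (Fin K → P.File) : ℝ) ≠ 0 := by exact_mod_cast Fintype.card_ne_zero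
  have := card_mul_marginal_eval (Fintype.card (Fin K → P.File) : ℝ)⁻¹ k a
  rw [mul_inv_cancel₀ hc'] at this
  rw [marginal_comp (p := P.serverLaw) Prod.fst (fun w => w k), hfst]
  exact eq_inv_of_mul_eq_one_right this

theorem entropy_file [NeZero K] (k : Fin K) :
    entropy P.law (fun ω => P.files ω k) = Real.log (Fintype.card P.File) := by
  rw [← entropy_file_server P k]
  exact P.entropy_law_of_server fun t => t.1 k

theorem entropy_commonRand [NeZero K] :
    entropy P.law P.commonRand = ∑ s, Real.negMulLog (P.lawS s) := by
  refine (P.entropy_law_of_server fun t => t.2).trans (Finset.sum_congr rfl fun s _ => ?_)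
  congr 1
  have hc : (Fintype.card (Fin K → P.File) : ℝ) ≠ 0 := by exact_mod_cast Fintype.card_ne_zero
  classical
  simp only [marginal, serverLaw, Fintype.sum_prod_type, Finset.sum_ite_eq', Finset.mem_univ,
    if_true, Finset.sum_const, Finset.card_univ, nsmul_eq_mul]
  exact mul_inv_cancel_left₀ hc _

/-- Independence under the joint law, for queries that determine the outcome of `Y`, gives
independence for a fixed value of the user's randomness. -/
theorem independent_serverLaw [NeZero K] {α β β' : Type*} [Fintype α] [Fintype β']
    {X : P.Outcome → α} {Y : P.Outcome → β} (h : Independent P.law X Y)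
    {X' : (Fin K → P.File) × P.S → α} {Y' : (Fin K → P.File) × P.S → β'} (ι : β' → β)
    (G : Fin K → P.U → Prop) {k : Fin K} {u : P.U} (hG : G k u) (hu : 0 < P.lawU u)
    (hX : ∀ k u, G k u → ∀ t : (Fin K → P.File) × P.S, X (k, t.1, u, t.2) = X' t)
    (hY : ∀ k u, G k u → ∀ (t : (Fin K → P.File) × P.S) b, Y (k, t.1, u, t.2) = ι b ↔ Y' t = b)
    (hn : ∀ k u, ¬ G k u → ∀ (t : (Fin K → P.File) × P.S) b, Y (k, t.1, u, t.2) ≠ ι b) :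
    Independent P.serverLaw X' Y' := by
  classical
  have hK : (0 : ℝ) < K := by exact_mod_cast NeZero.pos K
  have hnn : ∀ k u, 0 ≤ if G k u then (K : ℝ)⁻¹ * P.lawU u else 0 := fun k u => by
    have := P.lawU_nonneg u
    split_ifs <;> positivity
  -- The scaling constant is the probability of the event G, the only event on which Y takes a value
  -- of the form `ι b`.
  refine h.of_scaled P.sum_serverLaw ι
    (c := ∑ k, ∑ u, if G k u then (K : ℝ)⁻¹ * P.lawU u else 0) (ne_of_gt ?_) ?_
  · refine Finset.sum_pos' (fun k _ => Finset.sum_nonneg fun u _ => hnn k u) ⟨k, Finset.mem_univ k,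
      Finset.sum_pos' (fun u _ => hnn k u) ⟨u, Finset.mem_univ u, ?_⟩⟩
    rw [if_pos hG]
    positivity
  · intro a b
    rw [marginal_law]
    simp only [Finset.sum_mul]
    refine Finset.sum_congr rfl fun k _ => Finset.sum_congr rfl fun u _ => ?_
    split_ifs with hg
    · congr 1
      exact marginal_congr fun t => by simp [hX k u hg, hY k u hg]
    · have : marginal P.serverLaw
          (fun t => (X (k, t.1, u, t.2), Y (k, t.1, u, t.2))) (a, ι b) = 0 :=
        Finset.sum_eq_zero fun t _ => if_neg fun h => hn k u hg t b (Prod.mk.inj h).2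
      rw [this]
      ring

end Nonempty

end Protocol

theorem exists_otherFiles_eq {K : ℕ} (α : Type*) {k k' : Fin K} (h : k ≠ k') :
    ∃ j : Fin (K - 1), ∀ w : Fin K → α, otherFiles k' w j = w k := by
  have h' : k.1 ≠ k'.1 := fun h0 => h (Fin.ext h0)
  have := k.2
  have := k'.2
  rcases lt_or_gt_of_ne h' with hlt | hgt
  · exact ⟨⟨k.1, by omega⟩, fun w => by simp [otherFiles, hlt]⟩
  · refine ⟨⟨k.1 - 1, by omega⟩, fun w => ?_⟩
    rw [otherFiles, if_neg (by simp only; omega)]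
    congr 1
    ext
    simp only
    omega

theorem ext_of_otherFiles {K : ℕ} {α : Type*} {k : Fin K} {w w' : Fin K → α}
    (h : otherFiles k w = otherFiles k w') (hk : w k = w' k) : w = w' := by
  funext i
  by_cases hi : i = k
  · rw [hi, hk]
  · obtain ⟨j, hj⟩ := exists_otherFiles_eq α hi
    rw [← hj w, ← hj w', h]

/-! ### The converse: consequences of the four conditions for fixed user randomness, and the two
bounds. -/

namespace Protocol

variable {N K : ℕ} {F : Type*} [Fintype F] [Nonempty F] [NeZero K] (P : Protocol N K F)
variable {P}

/-- Any `N - 2B` answers determine the requested file. -/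
theorem Decodable.determines {B : ℕ} (h : P.Decodable B) {u : P.U} (hu : 0 < P.lawU u) (k : Fin K)
    {C : Finset (Fin N)} (hC : N ≤ C.card + 2 * B) (t t' : (Fin K → P.File) × P.S)
    (ht : 0 < P.serverLaw t) (ht' : 0 < P.serverLaw t')
    (heq : ∀ n ∈ C, P.answerTo u k n t = P.answerTo u k n t') : t.1 k = t'.1 k := by
  obtain ⟨decode, hd⟩ := h
  obtain ⟨B₁, hB₁, hB₁c⟩ := Finset.exists_subset_card_eq (s := Cᶜ) (n := min B Cᶜ.card)
    (min_le_right _ _)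
  have hcompl : Cᶜ.card ≤ 2 * B := by
    rw [Finset.card_compl, Fintype.card_fin]
    omega
  have hB₂c : (Cᶜ \ B₁).card ≤ B := by
    rw [Finset.card_sdiff_of_subset hB₁]
    omega
  -- This word differs from the answers at t only inside `B₁` and from those at t' only inside `Cᶜ \
  -- B₁`. Both sets have at most B elements, so it decodes to both files.
  let r : ∀ n, P.Ans n := fun n => if n ∈ B₁ then P.answerTo u k n t' else P.answerTo u k n t
  have h1 := hd (k, t.1, u, t.2) (P.law_pos_iff.2 ⟨hu, P.serverLaw_pos_iff.1 ht⟩) k B₁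
    (by omega) r fun n hn => by simp only [r, if_neg hn]; rfl
  have h2 := hd (k, t'.1, u, t'.2) (P.law_pos_iff.2 ⟨hu, P.serverLaw_pos_iff.1 ht'⟩) k (Cᶜ \ B₁)
    hB₂c r fun n hn => by
      by_cases hn1 : n ∈ B₁
      · simp only [r, if_pos hn1]; rfl
      · have hnC : n ∈ C := by
          by_contra hnC
          exact hn (Finset.mem_sdiff.2 ⟨Finset.mem_compl.2 hnC, hn1⟩)
        simp only [r, if_neg hn1, heq n hnC]; rfl
  exact h1.symm.trans h2

/-- The eavesdropper also sees the queries on X, so independence persists when these are fixed to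
the ones that u produces. -/
theorem EavesdropperPrivate.independent {E : ℕ} (h : P.EavesdropperPrivate E) {u : P.U}
    (hu : 0 < P.lawU u) (k : Fin K) {X : Finset (Fin N)} (hX : X.card ≤ E) :
    Independent P.serverLaw (fun t => t.1) (subfamily (P.answerTo u k) X) := by
  refine P.independent_serverLaw
    ((mutualInfo_eq_zero_iff P.law_nonneg P.sum_law _ _).1 (h X hX k))
    (fun b n => (P.query u k n, b n)) (fun _ u' => ∀ n : X, P.query u' k n = P.query u k n)
    (k := k) (u := u) (fun _ => rfl) hu (fun _ _ _ _ => rfl) ?_ ?_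
  · intro k' u' hu' t b
    simp only [funext_iff, transmissions, Prod.mk.injEq, subfamily, answer, answerTo, queries,
      files, commonRand]
    exact forall_congr' fun n => by rw [hu' n]; simp
  · intro k' u' hu' t b heq
    refine hu' fun n => ?_
    exact (Prod.mk.inj (congrFun heq n)).1

theorem DatabasePrivate.independent {B E : ℕ} (h : P.DatabasePrivate B E) {u : P.U}
    (hu : 0 < P.lawU u) (k : Fin K) :
    Independent P.serverLaw (fun t => otherFiles k t.1) (fun t n => P.answerTo u k n t) := by
  obtain ⟨s, -⟩ := P.exists_lawS_pos
  obtain ⟨w⟩ : Nonempty (Fin K → P.File) := inferInstance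
  -- With nothing overwritten the attack is irrelevant; answers at an arbitrary pair (w, s) serve as
  -- its values.
  have h0 := h ∅ ∅ (by simp) (by simp) fun _ n => P.answerTo u k n (w, s)
  refine P.independent_serverLaw
    ((mutualInfo_eq_zero_iff P.law_nonneg P.sum_law _ _).1 h0)
    (fun b => (b, P.query u, k)) (fun k' u' => k' = k ∧ P.query u' = P.query u)
    (k := k) (u := u) ⟨rfl, rfl⟩ hu ?_ ?_ ?_
  · rintro k' u' ⟨rfl, -⟩ t
    rfl
  · rintro k' u' ⟨rfl, hu'⟩ t b
    simp only [received, Finset.notMem_empty, if_false, answer, queries, index, hu', Prod.mk.injEq,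
      and_true, funext_iff, answerTo, files, commonRand]
  · intro k' u' hu' t b heq
    simp only [Prod.mk.injEq] at heq
    exact hu' ⟨heq.2.2, heq.2.1⟩

/-- Under independence any two individually possible values occur together: here the index k' and
the view on X that u produces for k. -/
theorem UserPrivate.exists_query_eq {T : ℕ} (h : P.UserPrivate T) {u : P.U} (hu : 0 < P.lawU u)
    (k k' : Fin K) {X : Finset (Fin N)} (hX : X.card = T) :
    ∃ u', 0 < P.lawU u' ∧ ∀ n ∈ X, P.query u' k' n = P.query u k n := by
  obtain ⟨s, hs⟩ := P.exists_lawS_pos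
  obtain ⟨w⟩ : Nonempty (Fin K → P.File) := inferInstance
  have hind := (mutualInfo_eq_zero_iff P.law_nonneg P.sum_law _ _).1 (h X hX)
  have pos : ∀ i, 0 < P.law (i, w, u, s) := fun i => P.law_pos_iff.2 ⟨hu, hs⟩
  set Y := fun ω => (P.transmissions X (P.index ω) ω, P.files ω, P.commonRand ω)
  have hY := (pos k).trans_le (le_marginal P.law_nonneg Y (k, w, u, s))
  have hk' := (pos k').trans_le (le_marginal P.law_nonneg P.index (k', w, u, s))
  have := mul_pos hk' hY
  rw [← hind] at this
  obtain ⟨⟨k₁, w₁, u₁, s₁⟩, heq, hpos⟩ := exists_of_marginal_pos this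
  simp only [Prod.mk.injEq] at heq
  obtain ⟨hidx, hYeq⟩ := heq
  have hk₁ : k₁ = k' := hidx
  subst hk₁
  refine ⟨u₁, (P.law_pos_iff.1 hpos).1, fun n hn => ?_⟩
  exact (Prod.mk.inj (congrFun (Prod.mk.inj hYeq).1 ⟨n, hn⟩)).1

/-- Any `max T E` answers are independent of the requested file. -/
theorem IsTBESPIR.independent {T B E : ℕ} (h : P.IsTBESPIR T B E) (hK : 2 ≤ K) {u : P.U}
    (hu : 0 < P.lawU u) (k : Fin K) {X : Finset (Fin N)} (hX : X.card = max T E) :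
    Independent P.serverLaw (fun t => t.1 k) (subfamily (P.answerTo u k) X) := by
  rcases le_total T E with hTE | hTE
  · exact (h.eavesdropperPrivate.independent hu k (hX.trans (max_eq_right hTE)).le).comp
      (fun w => w k) id
  -- The queries on X also occur in a request for some k' ≠ k, where W_k is among the files
  -- protected by database-privacy. This needs a second file.
  · have : Nontrivial (Fin K) := Fin.nontrivial_iff_two_le.2 hK
    obtain ⟨k', hk'⟩ := exists_ne k
    obtain ⟨u', hu', hq⟩ :=
      h.userPrivate.exists_query_eq hu k k' (hX.trans (max_eq_left hTE))
    obtain ⟨j, hj⟩ := exists_otherFiles_eq P.File hk'.symm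
    have hA : subfamily (P.answerTo u k) X = subfamily (P.answerTo u' k') X := by
      funext t n
      simp only [subfamily, answerTo, hq n n.2]
    have := (h.databasePrivate.independent hu' k').comp (fun v => v j)
      (fun a (n : X) => a n)
    simp only [hj] at this
    rw [hA]
    exact this

/-- The joint entropy of the answers exceeds that of the requested file by at most `H(S)`. -/
theorem IsTBESPIR.jointEntropy_le {T B E : ℕ} (h : P.IsTBESPIR T B E) {u : P.U}
    (hu : 0 < P.lawU u) (k : Fin K) (C : Finset (Fin N)) :
    jointEntropy P.serverLaw (P.answerTo u k) C ≤
      entropy P.serverLaw (fun t => t.1 k) + entropy P.serverLaw Prod.snd := by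
  have h0 := P.serverLaw_nonneg
  have h1 := P.sum_serverLaw
  -- Other files and answers are independent, and both are functions of (W, S); the entropy of the
  -- other files is then compared on both sides and cancels.
  have hind := ((h.databasePrivate.independent hu k).comp id (fun a (n : C) => a n)).entropy_pair
    h0 h1
  have h2 : entropy P.serverLaw (fun t => (otherFiles k t.1, fun n : C => P.answerTo u k n t)) ≤
      entropy P.serverLaw (fun t => ((otherFiles k t.1, t.1 k), t.2)) :=
    entropy_le_of_determines h0 fun t t' _ _ heq => by
      simp only [Prod.mk.injEq] at heq
      have : t = t' := Prod.ext (ext_of_otherFiles heq.1.1 heq.1.2) heq.2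
      rw [this]
  have h3 := entropy_pair_le h0 h1 (fun t => (otherFiles k t.1, t.1 k)) Prod.snd
  have h4 := entropy_pair_le h0 h1 (fun t => otherFiles k t.1) (fun t => t.1 k)
  simp only [id] at hind
  unfold jointEntropy
  change entropy P.serverLaw (fun t (n : C) => P.answerTo u k n t) ≤ _
  linarith

section Bounds

variable {T B E : ℕ} (h : P.IsTBESPIR T B E) (hK : 2 ≤ K) (hN : 2 * B + max T E < N) (k : Fin K)
include h hK hN

/-- One possible u suffices, since neither H(W_k) nor H(S) depends on it. -/
theorem IsTBESPIR.mul_entropy_file_le :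
    (max T E : ℕ) * entropy P.law (fun ω => P.files ω k) ≤
      ((N : ℝ) - 2 * B - (max T E : ℕ)) * entropy P.law P.commonRand := by
  obtain ⟨u, hu⟩ := P.exists_lawU_pos
  obtain ⟨C, -, hC⟩ := Finset.exists_subset_card_eq (s := (Finset.univ : Finset (Fin N)))
    (n := N - 2 * B) (by simp)
  have := mul_entropy_le_of_ramp P.serverLaw_nonneg P.sum_serverLaw (n := N - 2 * B)
    (M := max T E) (by omega) hC (fun X hX => h.independent hK hu k hX)
    (fun t t' => h.decodable.determines hu k (by omega) t t')
    (h.jointEntropy_le hu k C)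
  rw [Nat.cast_sub (by omega)] at this
  push_cast at this ⊢
  rw [entropy_file, ← entropy_file_server]
  exact this.trans_eq (by rw [← P.entropy_law_of_server Prod.snd]; rfl)

/-- The answer entropies do depend on u; their average over u is at most the unconditional entropy,
by concavity. -/
theorem IsTBESPIR.mul_entropy_file_le_sum_answer :
    (N : ℝ) * entropy P.law (fun ω => P.files ω k) ≤
      ((N : ℝ) - 2 * B - (max T E : ℕ)) * ∑ n, entropy P.law (P.answer k n) := by
  have key : ∀ u, 0 < P.lawU u → (N : ℝ) * entropy P.law (fun ω => P.files ω k) ≤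
      ((N : ℝ) - 2 * B - (max T E : ℕ)) *
        ∑ n, entropy P.serverLaw (P.answerTo u k n) := fun u hu => by
    have := card_mul_le_of_forall_sum (d := N - 2 * B - max T E) (by simp; omega)
      (entropy_le_sum_of_ramp P.serverLaw_nonneg P.sum_serverLaw (n := N - 2 * B) (M := max T E)
        (by omega) (by simp) (fun X hX => h.independent hK hu k hX)
        (fun C hC t t' => h.decodable.determines hu k (by omega) t t'))
    rw [Nat.cast_sub (by omega), Nat.cast_sub (by omega), Fintype.card_fin] at this
    push_cast at this ⊢
    rwa [entropy_file, ← P.entropy_file_server k]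
  have conc : ∀ n, ∑ u, P.lawU u * entropy P.serverLaw (P.answerTo u k n) ≤
      entropy P.law (P.answer k n) := fun n =>
    sum_mul_entropy_le P.lawU_nonneg P.sum_lawU P.serverLaw_nonneg fun a => by
      rw [marginal_law]
      change ∑ _k : Fin K, ∑ u, (K : ℝ)⁻¹ * P.lawU u * marginal P.serverLaw (P.answerTo u k n) a = _
      simp [mul_assoc, ← Finset.mul_sum, NeZero.ne K]
  have hd : (0 : ℝ) ≤ (N : ℝ) - 2 * B - (max T E : ℕ) := by
    have : ((2 * B + max T E : ℕ) : ℝ) ≤ N := by exact_mod_cast hN.le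
    push_cast at this ⊢
    linarith
  calc (N : ℝ) * entropy P.law (fun ω => P.files ω k)
      = ∑ u, P.lawU u * ((N : ℝ) * entropy P.law (fun ω => P.files ω k)) := by
        rw [← Finset.sum_mul, sum_lawU, one_mul]
    _ ≤ ∑ u, P.lawU u * (((N : ℝ) - 2 * B - (max T E : ℕ)) *
          ∑ n, entropy P.serverLaw (P.answerTo u k n)) := Finset.sum_le_sum fun u _ => by
        rcases (P.lawU_nonneg u).eq_or_lt with h0 | h0
        · simp [← h0]
        · exact mul_le_mul_of_nonneg_left (key u h0) h0.le
    _ = ((N : ℝ) - 2 * B - (max T E : ℕ)) *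
          ∑ n, ∑ u, P.lawU u * entropy P.serverLaw (P.answerTo u k n) := by
        rw [Finset.sum_comm, Finset.mul_sum]
        refine Finset.sum_congr rfl fun u _ => ?_
        rw [Finset.mul_sum, Finset.mul_sum, Finset.mul_sum]
        exact Finset.sum_congr rfl fun n _ => by ring
    _ ≤ _ := mul_le_mul_of_nonneg_left (Finset.sum_le_sum fun n _ => conc n) hd

end Bounds

end Protocol

/-! ### Polynomial evaluation and interpolation. -/

section Polynomials

variable {𝔽 : Type*} [Field 𝔽]

/-- The value at `x` of the polynomial with coefficients `c`. -/
def evalCoeffs {m : ℕ} (c : Fin m → 𝔽) (x : 𝔽) : 𝔽 := ∑ i, c i * x ^ (i : ℕ)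

theorem evalCoeffs_add {m : ℕ} (c c' : Fin m → 𝔽) (x : 𝔽) :
    evalCoeffs (c + c') x = evalCoeffs c x + evalCoeffs c' x := by
  simp [evalCoeffs, add_mul, Finset.sum_add_distrib]

theorem evalCoeffs_sub {m : ℕ} (c c' : Fin m → 𝔽) (x : 𝔽) :
    evalCoeffs (c - c') x = evalCoeffs c x - evalCoeffs c' x := by
  simp [evalCoeffs, sub_mul, Finset.sum_sub_distrib]

theorem evalCoeffs_zero {m : ℕ} (x : 𝔽) : evalCoeffs (0 : Fin m → 𝔽) x = 0 := by
  simp [evalCoeffs]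

theorem exists_evalCoeffs_eq {ι : Type*} {x : ι → 𝔽} (hx : Function.Injective x) {m : ℕ}
    (X : Finset ι) (hX : X.card ≤ m) (v : ι → 𝔽) :
    ∃ c : Fin m → 𝔽, ∀ n ∈ X, evalCoeffs c (x n) = v n := by
  classical
  -- For empty X the number m may be 0, and then no `natDegree` lies below m.
  rcases X.eq_empty_or_nonempty with rfl | hne
  · exact ⟨0, by simp⟩
  refine ⟨fun i => (Lagrange.interpolate X x v).coeff i, fun n hn => ?_⟩
  have hm : 0 < m := (Finset.card_pos.2 hne).trans_le hX
  have hdeg : (Lagrange.interpolate X x v).natDegree < m := by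
    by_cases h0 : Lagrange.interpolate X x v = 0
    · simpa [h0] using hm
    · rw [Polynomial.natDegree_lt_iff_degree_lt h0]
      exact (Lagrange.degree_interpolate_lt v hx.injOn).trans_le (by exact_mod_cast hX)
  rw [← Lagrange.eval_interpolate_at_node v hx.injOn hn, Polynomial.eval_eq_sum_range' hdeg,
    ← Fin.sum_univ_eq_sum_range (fun i => (Lagrange.interpolate X x v).coeff i * x n ^ i)]
  rfl

/-- The difference of the two polynomials has m + d coefficients and vanishes at m + d distinct
points, so the Vandermonde system forces it to be zero. -/
theorem high_coeffs_unique {ι : Type*} {x : ι → 𝔽} (hx : Function.Injective x) {m d : ℕ}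
    (X : Finset ι) (hX : m + d ≤ X.card) {c c' : Fin m → 𝔽} {w w' : Fin d → 𝔽}
    (h : ∀ n ∈ X, evalCoeffs c (x n) + ∑ j : Fin d, x n ^ (m + j : ℕ) * w j =
      evalCoeffs c' (x n) + ∑ j : Fin d, x n ^ (m + j : ℕ) * w' j) : w = w' := by
  let f : Fin (m + d) → X := fun i => X.equivFin.symm (Fin.castLE hX i)
  have hf : Function.Injective fun i => x (f i) := fun i j hij => by
    have := Subtype.ext (hx hij)
    simpa [f] using this
  have := Matrix.eq_zero_of_forall_index_sum_pow_mul_eq_zero (v := Fin.append (c - c') (w - w')) hf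
    fun i => by
      have hi := h (f i) (f i).2
      simp only [Fin.sum_univ_add, Fin.append_left, Fin.append_right, Fin.val_castAdd,
        Fin.val_natAdd, Pi.sub_apply, mul_sub, Finset.sum_sub_distrib]
      simp only [evalCoeffs, mul_comm (_ : 𝔽) (x (f i) ^ (_ : ℕ))] at hi
      linear_combination hi
  funext j
  have hj := congrFun this (Fin.natAdd m j)
  simpa [sub_eq_zero] using hj

end Polynomials

/-! ### Auxiliary distributions and the reduction of attacks to authentic answers. -/

theorem exists_otherFiles {K : ℕ} {α : Type*} (k : Fin K) (v : α) (x : Fin (K - 1) → α) :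
    ∃ w : Fin K → α, otherFiles k w = x ∧ w k = v := by
  have hk := k.2
  refine ⟨fun i => if h : i.1 < k.1 then x ⟨i.1, by omega⟩ else
    if h' : i.1 = k.1 then v else x ⟨i.1 - 1, by omega⟩, ?_, by simp⟩
  funext j
  simp only [otherFiles]
  split_ifs with h1 h2 h3
  · rfl
  · omega
  · omega
  · simp

/-- Intermediate value theorem on the segment from a point mass to the uniform law on n + 1 ≥ exp h
points. It supplies the padding of the common randomness. -/
theorem exists_entropy_eq {h : ℝ} (hh : 0 ≤ h) : ∃ (n : ℕ) (q : stdSimplex ℝ (Fin (n + 1))),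
    ∑ z, Real.negMulLog (q z) = h := by
  obtain ⟨n, hn⟩ := exists_nat_ge (Real.exp h)
  have hlog : h ≤ Real.log ((n + 1 : ℕ) : ℝ) := by
    rw [Real.le_log_iff_exp_le (by positivity)]
    push_cast
    linarith
  let q : ℝ → Fin (n + 1) → ℝ := fun t z =>
    (1 - t) * (if z = 0 then 1 else 0) + t * ((n + 1 : ℕ) : ℝ)⁻¹
  have hne : ((n + 1 : ℕ) : ℝ) ≠ 0 := by positivity
  have hcont : Continuous fun t => ∑ z, Real.negMulLog (q t z) := by
    refine continuous_finsetSum _ fun z _ => Real.continuous_negMulLog.comp ?_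
    fun_prop
  obtain ⟨t, ht, hqt⟩ := intermediate_value_Icc (zero_le_one' ℝ) hcont.continuousOn
    (show h ∈ Set.Icc _ _ from ⟨by
      refine le_trans (le_of_eq ?_) hh
      refine Finset.sum_eq_zero fun z _ => ?_
      by_cases hz : z = 0 <;> simp [q, hz], by
      refine hlog.trans (le_of_eq ?_)
      simp only [q, sub_self, zero_mul, zero_add, one_mul, Finset.sum_const, Finset.card_univ,
        Fintype.card_fin, nsmul_eq_mul, Real.negMulLog, Real.log_inv]
      field_simp⟩)
  refine ⟨n, ⟨q t, fun z => ?_, ?_⟩, hqt⟩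
  · have h0 := ht.1
    have h1 := sub_nonneg.2 ht.2
    have : (0 : ℝ) ≤ if z = 0 then 1 else 0 := by split_ifs <;> simp
    simp only [q]
    positivity
  · simp only [q, Finset.sum_add_distrib, ← Finset.mul_sum, Finset.sum_ite_eq', Finset.mem_univ,
      if_true, Finset.sum_const, Finset.card_univ, Fintype.card_fin, nsmul_eq_mul]
    field_simp
    ring

/-- The uniform distribution. -/
noncomputable def uniformSimplex (α : Type*) [Fintype α] [Nonempty α] : stdSimplex ℝ α :=
  ⟨fun _ => (Fintype.card α : ℝ)⁻¹, fun _ => by positivity, by simp⟩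

/-- The product of two distributions. -/
def prodSimplex {α β : Type*} [Fintype α] [Fintype β] (p : stdSimplex ℝ α) (q : stdSimplex ℝ β) :
    stdSimplex ℝ (α × β) :=
  ⟨fun t => p t.1 * q t.2, fun t => mul_nonneg (p.2.1 _) (q.2.1 _), by
    rw [Fintype.sum_prod_type]
    simp [← Finset.mul_sum]⟩

theorem sum_negMulLog_prodSimplex {α β : Type*} [Fintype α] [Fintype β] (p : stdSimplex ℝ α)
    (q : stdSimplex ℝ β) : ∑ t, Real.negMulLog (prodSimplex p q t) =
      ∑ a, Real.negMulLog (p a) + ∑ b, Real.negMulLog (q b) := by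
  have : ∀ t, Real.negMulLog (prodSimplex p q t) =
      q t.2 * Real.negMulLog (p t.1) + p t.1 * Real.negMulLog (q t.2) := fun t =>
    Real.negMulLog_mul _ _
  simp only [this, Fintype.sum_prod_type, Finset.sum_add_distrib, ← Finset.sum_mul,
    ← Finset.mul_sum]
  simp

/-- An attack uses only queries and authentic answers, so it cannot reveal more about the database
than these do. -/
theorem Protocol.received_congr {N K : ℕ} {F : Type*} {P : Protocol N K F} {𝓔 𝓑 : Finset (Fin N)}
    {attack : (∀ n : 𝓔, P.Qry n × P.Ans n) → ∀ n, P.Ans n} {k : Fin K} {ω ω' : P.Outcome}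
    (h : ∀ n, P.answer k n ω = P.answer k n ω') (hq : P.queries ω = P.queries ω') :
    P.received 𝓔 𝓑 attack k ω = P.received 𝓔 𝓑 attack k ω' := by
  have htrans : P.transmissions 𝓔 k ω = P.transmissions 𝓔 k ω' := by
    funext n
    simp only [transmissions, h, hq]
  funext n
  simp only [received, htrans, h]

/-! ### The polynomial scheme and its four properties. -/

section Scheme

variable {N K : ℕ} {F : Type*} {𝔽 : Type} [Field 𝔽] {L M d : ℕ}

/-- The interference of the files in the answers. -/
def interference (e : (Fin L → F) ≃ (Fin d → 𝔽)) (u : Fin K → Fin d → Fin M → 𝔽)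
    (W : Fin K → Fin L → F) (m : Fin M) : 𝔽 := ∑ i, ∑ j, u i j m * e (W i) j

theorem evalCoeffs_interference (e : (Fin L → F) ≃ (Fin d → 𝔽)) (u : Fin K → Fin d → Fin M → 𝔽)
    (W : Fin K → Fin L → F) (y : 𝔽) :
    evalCoeffs (interference e u W) y = ∑ i, ∑ j, evalCoeffs (u i j) y * e (W i) j := by
  simp only [evalCoeffs, interference, Finset.sum_mul]
  rw [Finset.sum_comm]
  refine Finset.sum_congr rfl fun i _ => ?_
  rw [Finset.sum_comm]
  exact Finset.sum_congr rfl fun j _ => Finset.sum_congr rfl fun m _ => by ring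

/-- The files enter as scalars, so the masks contribute only to the M low coefficients, while the
monomials in the query place file k alone in the d coefficients above. -/
theorem sum_mul_add_evalCoeffs {e : (Fin L → F) ≃ (Fin d → 𝔽)} (u : Fin K → Fin d → Fin M → 𝔽)
    (W : Fin K → Fin L → F) (s : Fin M → 𝔽) (k : Fin K) (y : 𝔽) :
    ∑ i, ∑ j : Fin d, (evalCoeffs (u i j) y + if i = k then y ^ (M + j : ℕ) else 0) * e (W i) j +
        evalCoeffs s y =
      evalCoeffs (interference e u W + s) y + ∑ j : Fin d, y ^ (M + j : ℕ) * e (W k) j := by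
  rw [evalCoeffs_add, evalCoeffs_interference]
  simp only [add_mul, Finset.sum_add_distrib, ite_mul, zero_mul]
  have : ∑ i, ∑ j : Fin d, (if i = k then y ^ (M + j : ℕ) * e (W i) j else 0) =
      ∑ j : Fin d, y ^ (M + j : ℕ) * e (W k) j := by
    rw [Finset.sum_comm]
    simp
  rw [this]
  ring

variable [Fintype 𝔽]

/-- The retrieval scheme in which queries, common randomness and answers are evaluations of
polynomials over a field `𝔽`: query and common randomness are masked by random polynomials with `M`
coefficients, and the requested file appears as the `d` coefficients above those. The component in
`Z` of the common randomness is not used. -/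
noncomputable def polyScheme (K : ℕ) (x : Fin N → 𝔽) (hL : 0 < L)
    (e : (Fin L → F) ≃ (Fin d → 𝔽)) (M : ℕ) {Z : Type} [Fintype Z] (q : stdSimplex ℝ Z) :
    Protocol N K F where
  L := L
  L_pos := hL
  U := Fin K → Fin d → Fin M → 𝔽
  fintypeU := by classical infer_instance
  lawU := by classical exact uniformSimplex _
  S := (Fin M → 𝔽) × Z
  fintypeS := by classical infer_instance
  lawS := by classical exact prodSimplex (uniformSimplex _) q
  R _ := 𝔽
  nodeRand n s := evalCoeffs s.1 (x n)
  Qry _ := Fin K → Fin d → 𝔽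
  fintypeQry _ := by classical infer_instance
  Ans _ := 𝔽
  query u k n i j := evalCoeffs (u i j) (x n) + if i = k then x n ^ (M + j : ℕ) else 0
  respond _ Q W r := ∑ i, ∑ j, Q i j * e (W i) j + r

variable {x : Fin N → 𝔽} {hL : 0 < L} {e : (Fin L → F) ≃ (Fin d → 𝔽)} {Z : Type} [Fintype Z]
  {q : stdSimplex ℝ Z}

theorem polyScheme_answer (k : Fin K) (n : Fin N) (ω : (polyScheme K x hL e M q).Outcome) :
    (polyScheme K x hL e M q).answer k n ω =
      evalCoeffs (interference e ω.2.2.1 ω.2.1 + ω.2.2.2.1) (x n) +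
        ∑ j : Fin d, x n ^ (M + j : ℕ) * e (ω.2.1 k) j :=
  sum_mul_add_evalCoeffs (e := e) ω.2.2.1 ω.2.1 ω.2.2.2.1 k (x n)

theorem polyScheme_answer_congr {k : Fin K} (n : Fin N)
    {ω ω' : (polyScheme K x hL e M q).Outcome} (hf : ω.2.1 k = ω'.2.1 k)
    (hi : interference e ω.2.2.1 ω.2.1 + ω.2.2.2.1 =
      interference e ω'.2.2.1 ω'.2.1 + ω'.2.2.2.1) :
    (polyScheme K x hL e M q).answer k n ω = (polyScheme K x hL e M q).answer k n ω' := by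
  refine (polyScheme_answer k n ω).trans (Eq.trans ?_ (polyScheme_answer k n ω').symm)
  rw [hf, hi]

variable (hx : Function.Injective x) {T B E : ℕ}

include hx

/-- Outside both corrupted sets at least N - 2B ≥ M + d answers agree, which fixes the high
coefficients. -/
theorem polyScheme_files_eq (hMd : M + d + 2 * B ≤ N) {k : Fin K} {r : Fin N → 𝔽}
    {ω ω' : (polyScheme K x hL e M q).Outcome} {𝓑 𝓑' : Finset (Fin N)} (h𝓑 : 𝓑.card ≤ B)
    (h𝓑' : 𝓑'.card ≤ B) (hr : ∀ n, n ∉ 𝓑 → r n = (polyScheme K x hL e M q).answer k n ω)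
    (hr' : ∀ n, n ∉ 𝓑' → r n = (polyScheme K x hL e M q).answer k n ω') :
    (polyScheme K x hL e M q).files ω k = (polyScheme K x hL e M q).files ω' k := by
  have hcard : M + d ≤ (𝓑 ∪ 𝓑')ᶜ.card := by
    have := Finset.card_union_le 𝓑 𝓑'
    rw [Finset.card_compl, Fintype.card_fin]
    omega
  refine e.injective (high_coeffs_unique hx _ hcard
    (c := interference e ω.2.2.1 ω.2.1 + ω.2.2.2.1)
    (c' := interference e ω'.2.2.1 ω'.2.1 + ω'.2.2.2.1) fun n hn => ?_)
  rw [Finset.mem_compl, Finset.notMem_union] at hn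
  exact (polyScheme_answer k n ω).symm.trans (((hr n hn.1).symm.trans (hr' n hn.2)).trans
    (polyScheme_answer k n ω'))

variable [Fintype F] [Nonempty F]

theorem polyScheme_decodable (hMd : M + d + 2 * B ≤ N) :
    (polyScheme K x hL e M q).Decodable B := by
  have : Nonempty (polyScheme K x hL e M q).File := ⟨fun _ => Classical.arbitrary F⟩
  -- The decoder picks any file consistent with the received word up to B overwritten answers;
  -- `polyScheme_files_eq` makes it unique.
  refine ⟨fun _ k r => Classical.epsilon fun w => ∃ ω, ∃ 𝓑 : Finset (Fin N), 𝓑.card ≤ B ∧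
    (∀ n, n ∉ 𝓑 → r n = (polyScheme K x hL e M q).answer k n ω) ∧
      (polyScheme K x hL e M q).files ω k = w, fun ω _ k 𝓑 h𝓑 r hr => ?_⟩
  obtain ⟨ω', 𝓑', h𝓑', hr', hw⟩ := Classical.epsilon_spec (p := fun w => ∃ ω, ∃ 𝓑 : Finset (Fin N), 𝓑.card ≤ B ∧
    (∀ n, n ∉ 𝓑 → r n = (polyScheme K x hL e M q).answer k n ω) ∧
      (polyScheme K x hL e M q).files ω k = w) ⟨_, ω, 𝓑, h𝓑, hr, rfl⟩
  exact hw.symm.trans (polyScheme_files_eq hx hMd h𝓑' h𝓑 hr' hr)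

theorem polyScheme_userPrivate [NeZero K] (hT : T ≤ M) :
    (polyScheme K x hL e M q).UserPrivate T := by
  intro 𝓣 h𝓣
  -- On 𝓣 the monomial of degree M + j coincides with a polynomial of M coefficients, so shifting
  -- the masks by `c j` trades index k for k' without changing the queries there.
  choose c hc using fun j : Fin d =>
    exists_evalCoeffs_eq hx (m := M) 𝓣 (by omega) fun n => x n ^ (M + j : ℕ)
  refine mutualInfo_eq_zero_of_symmetry (Protocol.law_nonneg _) (Protocol.sum_law _) fun k k' =>
    ⟨fun ω => (k', ω.2.1, fun i j => ω.2.2.1 i j + ((if i = k then c j else 0) -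
      if i = k' then c j else 0), ω.2.2.2), ?_, ?_⟩
  · rintro ⟨κ, W, u, s⟩ hκ ⟨κ', W', u', s'⟩ hκ' heq
    have h1 : κ = k := hκ
    have h2 : κ' = k := hκ'
    have hW : W = W' := congrArg (fun ω => ω.2.1) heq
    have hs : s = s' := congrArg (fun ω => ω.2.2.2) heq
    have hu' : u = u' := by
      funext i j
      exact add_right_cancel (congrFun (congrFun (congrArg (fun ω => ω.2.2.1) heq) i) j)
    rw [h1, h2, hW, hu', hs]
  · rintro ⟨κ, W, u, s⟩ hκ
    have h1 : κ = k := hκ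
    subst h1
    have hq : ∀ n ∈ 𝓣, (polyScheme K x hL e M q).query (fun i j => u i j +
        ((if i = κ then c j else 0) - if i = k' then c j else 0)) k' n =
        (polyScheme K x hL e M q).query u κ n := fun n hn => by
      funext i j
      have hj := hc j n hn
      change evalCoeffs (u i j + ((if i = κ then c j else 0) - if i = k' then c j else 0)) (x n) +
        (if i = k' then x n ^ (M + j : ℕ) else 0) =
        evalCoeffs (u i j) (x n) + if i = κ then x n ^ (M + j : ℕ) else 0
      rw [evalCoeffs_add, evalCoeffs_sub, apply_ite (evalCoeffs · (x n)),
        apply_ite (evalCoeffs · (x n)), evalCoeffs_zero, hj]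
      ring
    refine ⟨rfl, rfl, Prod.ext (funext fun n => ?_) rfl⟩
    simp only [Protocol.transmissions, Protocol.answer, Protocol.queries, Protocol.index]
    rw [hq n n.2]
    rfl

theorem polyScheme_eavesdropperPrivate [NeZero K] (hE : E ≤ M) :
    (polyScheme K x hL e M q).EavesdropperPrivate E := by
  intro 𝓔 h𝓔 k
  refine mutualInfo_eq_zero_of_symmetry (Protocol.law_nonneg _) (Protocol.sum_law _) fun W W' => ?_
  -- The shift `c u` of the common randomness compensates on 𝓔 for replacing W by W'. It depends
  -- only on u, which stays fixed, so the map is injective.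
  choose c hc using fun u => exists_evalCoeffs_eq hx (m := M) 𝓔 (by omega) fun n =>
    ∑ i, ∑ j, (polyScheme K x hL e M q).query u k n i j * e (W i) j -
      ∑ i, ∑ j, (polyScheme K x hL e M q).query u k n i j * e (W' i) j
  refine ⟨fun ω => (ω.1, W', ω.2.2.1, (ω.2.2.2.1 + c ω.2.2.1, ω.2.2.2.2)), ?_, ?_⟩
  · rintro ⟨κ, V, u, s, z⟩ hV ⟨κ', V', u', s', z'⟩ hV' heq
    have h1 : V = W := hV
    have h2 : V' = W := hV'
    have hκ : κ = κ' := congrArg (fun ω => ω.1) heq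
    have hu : u = u' := congrArg (fun ω => ω.2.2.1) heq
    have hs : s + c u = s' + c u' := congrArg (fun ω => ω.2.2.2.1) heq
    have hz : z = z' := congrArg (fun ω => ω.2.2.2.2) heq
    subst hu
    rw [h1, h2, hκ, add_right_cancel hs, hz]
  · rintro ⟨κ, V, u, s, z⟩ hV
    have h1 : V = W := hV
    subst h1
    refine ⟨rfl, rfl, funext fun n => Prod.ext rfl ?_⟩
    change ∑ i, ∑ j, (polyScheme K x hL e M q).query u k n i j * e (W' i) j +
      evalCoeffs (s + c u) (x n) =
      ∑ i, ∑ j, (polyScheme K x hL e M q).query u k n i j * e (V i) j + evalCoeffs s (x n)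
    rw [evalCoeffs_add, hc u n n.2]
    ring

omit hx in
theorem polyScheme_databasePrivate [NeZero K] :
    (polyScheme K x hL e M q).DatabasePrivate B E := by
  intro 𝓔 𝓑 _ _ attack
  refine mutualInfo_eq_zero_of_symmetry (Protocol.law_nonneg _) (Protocol.sum_law _) fun v v' => ?_
  choose w hw using fun (κ : Fin K) (y : Fin L → F) => exists_otherFiles κ y v'
  -- The desired file is kept and the others become v'; the common randomness absorbs the change of
  -- interference, so the whole answer polynomial is unchanged.
  refine ⟨fun ω => (ω.1, w ω.1 (ω.2.1 ω.1), ω.2.2.1, (ω.2.2.2.1 + (interference e ω.2.2.1 ω.2.1 -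
    interference e ω.2.2.1 (w ω.1 (ω.2.1 ω.1))), ω.2.2.2.2)), ?_, ?_⟩
  · rintro ⟨κ, V, u, s, z⟩ hV ⟨κ', V', u', s', z'⟩ hV' heq
    obtain rfl : κ = κ' := congrArg (fun ω => ω.1) heq
    have hW : w κ (V κ) = w κ (V' κ) := congrArg (fun ω => ω.2.1) heq
    obtain rfl : u = u' := congrArg (fun ω => ω.2.2.1) heq
    obtain rfl : z = z' := congrArg (fun ω => ω.2.2.2.2) heq
    have hVV : V = V' := ext_of_otherFiles (k := κ) (Eq.trans hV (Eq.symm hV')) (by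
      have := congrFun hW κ
      rwa [(hw κ (V κ)).2, (hw κ (V' κ)).2] at this)
    subst hVV
    obtain rfl : s = s' := add_right_cancel (congrArg (fun ω => ω.2.2.2.1) heq)
    rfl
  · rintro ⟨κ, V, u, s, z⟩ hV
    refine ⟨rfl, (hw κ (V κ)).1, Prod.ext (Protocol.received_congr (fun n => ?_) rfl) rfl⟩
    exact polyScheme_answer_congr n (hw κ (V κ)).2
      (show interference e u (w κ (V κ)) + (s + (interference e u V -
        interference e u (w κ (V κ)))) = interference e u V + s by abel)

theorem polyScheme_isTBESPIR [NeZero K] (hT : T ≤ M) (hE : E ≤ M) (hMd : M + d + 2 * B ≤ N) :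
    (polyScheme K x hL e M q).IsTBESPIR T B E :=
  ⟨polyScheme_decodable hx hMd, polyScheme_userPrivate hx hT, polyScheme_databasePrivate,
    polyScheme_eavesdropperPrivate hx hE⟩

omit hx

theorem polyScheme_entropy_file [NeZero K] (k : Fin K) :
    entropy (polyScheme K x hL e M q).law (fun ω => (polyScheme K x hL e M q).files ω k) =
      d * Real.log (Fintype.card 𝔽) := by
  classical
  rw [Protocol.entropy_file]
  change Real.log (Fintype.card (Fin L → F)) = _
  rw [Fintype.card_congr e]
  simp

theorem polyScheme_entropy_commonRand [NeZero K] :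
    entropy (polyScheme K x hL e M q).law (polyScheme K x hL e M q).commonRand =
      M * Real.log (Fintype.card 𝔽) + ∑ z, Real.negMulLog (q z) := by
  classical
  rw [Protocol.entropy_commonRand]
  refine (sum_negMulLog_prodSimplex (uniformSimplex (Fin M → 𝔽)) q).trans ?_
  congr 1
  change ∑ _a : Fin M → 𝔽, Real.negMulLog (Fintype.card (Fin M → 𝔽) : ℝ)⁻¹ = _
  have : (Fintype.card 𝔽 : ℝ) ≠ 0 := by exact_mod_cast Fintype.card_ne_zero
  simp [Real.negMulLog]

theorem polyScheme_sum_entropy_answer_le [NeZero K] (k : Fin K) :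
    ∑ n, entropy (polyScheme K x hL e M q).law ((polyScheme K x hL e M q).answer k n) ≤
      N * Real.log (Fintype.card 𝔽) := by
  refine (Finset.sum_le_sum fun n _ => entropy_le_log_card (Protocol.law_nonneg _)
    (Protocol.sum_law _) ((polyScheme K x hL e M q).answer k n)).trans (le_of_eq ?_)
  change ∑ _n : Fin N, Real.log (Fintype.card 𝔽) = _
  simp

end Scheme

/-! ### Choice of parameters and the capacity. -/

/-- Over any finite field, some power of its cardinality is the cardinality of a field with at least
`N` elements. -/
theorem exists_large_field (F : Type*) [Field F] [Fintype F] (N : ℕ) :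
    ∃ (m : ℕ) (𝔽 : Type) (_ : Field 𝔽) (_ : Fintype 𝔽), 0 < m ∧ N ≤ Fintype.card 𝔽 ∧
      Fintype.card 𝔽 = Fintype.card F ^ m := by
  obtain ⟨p, hp⟩ := CharP.exists F
  obtain ⟨r, hprime, hcard⟩ := FiniteField.card F p
  have : Fact p.Prime := ⟨hprime⟩
  have hr := r.pos
  -- The degree N + 1 over F is positive even for N = 0, and |F|^(N + 1) exceeds N.
  have hfin := GaloisField.card p (r * (N + 1)) (by positivity)
  have hF : Fintype.card F ^ (N + 1) = p ^ ((r : ℕ) * (N + 1)) := by rw [hcard, pow_mul]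
  let _ : Fintype (GaloisField p (r * (N + 1))) := Fintype.ofFinite _
  rw [Nat.card_eq_fintype_card, ← hF] at hfin
  refine ⟨N + 1, GaloisField p (r * (N + 1)), inferInstance, inferInstance, by omega, ?_, hfin⟩
  rw [hfin]
  exact (Nat.lt_succ_self N).le.trans (Nat.lt_pow_self Fintype.one_lt_card).le

/-- Here l is the entropy of one uniform symbol of the extension field, and ε l that of the unused
padding. -/
theorem exists_isTBESPIR (F : Type*) [Field F] [Fintype F] {N K T B E d : ℕ} [NeZero K]
    (hd : 0 < d) (hN : max T E + d + 2 * B ≤ N) {ε : ℝ} (hε : 0 ≤ ε) :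
    ∃ (P : Protocol N K F) (l : ℝ), 0 < l ∧ P.IsTBESPIR T B E ∧
      entropy P.law P.commonRand = (max T E : ℕ) * l + ε * l ∧
      ∀ k, entropy P.law (fun ω => P.files ω k) = d * l ∧
        ∑ n, entropy P.law (P.answer k n) ≤ N * l := by
  obtain ⟨m, 𝔽, _, _, hm, hcard, hpow⟩ := exists_large_field F N
  obtain ⟨x⟩ : Nonempty (Fin N ↪ 𝔽) :=
    Function.Embedding.nonempty_of_card_le (by simpa using hcard)
  classical
  -- Any bijection will do: the scheme needs no linearity over F, only files of L = m d symbols.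
  have e : (Fin (m * d) → F) ≃ (Fin d → 𝔽) := Fintype.equivOfCardEq (by simp [hpow, pow_mul])
  have hl : 0 < Real.log (Fintype.card 𝔽) :=
    Real.log_pos (by exact_mod_cast Fintype.one_lt_card)
  obtain ⟨n, q, hq⟩ := exists_entropy_eq (mul_nonneg hε hl.le)
  refine ⟨polyScheme K x (Nat.mul_pos hm hd) e (max T E) q, _, hl,
    polyScheme_isTBESPIR x.injective (le_max_left _ _) (le_max_right _ _) hN, ?_,
    fun k => ⟨polyScheme_entropy_file k, polyScheme_sum_entropy_answer_le k⟩⟩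
  rw [polyScheme_entropy_commonRand, hq]

theorem mainTheorem3 {F : Type*} [Field F] [Fintype F] (N K T B E : ℕ) (hK : 2 ≤ K)
    (hN : 2 * B + max T E < N) :
    (∀ P : Protocol N K F, P.IsTBESPIR T B E → ∀ k : Fin K,
      ((max T E : ℕ) : ℝ) / ((N : ℝ) - 2 * (B : ℝ) - ((max T E : ℕ) : ℝ)) ≤ P.secrecyRate k ∧
      P.rate k ≤ 1 - (2 * (B : ℝ) + ((max T E : ℕ) : ℝ)) / (N : ℝ)) ∧
    ∀ ρ : ℝ, capacityTBESPIR N K F T B E ρ =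
      if ((max T E : ℕ) : ℝ) / ((N : ℝ) - 2 * (B : ℝ) - ((max T E : ℕ) : ℝ)) ≤ ρ
      then 1 - (2 * (B : ℝ) + ((max T E : ℕ) : ℝ)) / (N : ℝ)
      else 0 := by
  have : NeZero K := ⟨by omega⟩
  have hd : (0 : ℝ) < (N : ℝ) - 2 * (B : ℝ) - ((max T E : ℕ) : ℝ) := by
    have : ((2 * B + max T E : ℕ) : ℝ) < N := by exact_mod_cast hN
    push_cast at this ⊢
    linarith
  have hN0 : (0 : ℝ) < N := by exact_mod_cast (by omega : 0 < N)
  set δ : ℝ := (N : ℝ) - 2 * (B : ℝ) - ((max T E : ℕ) : ℝ) with hδ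
  have hrate : 1 - (2 * (B : ℝ) + ((max T E : ℕ) : ℝ)) / (N : ℝ) = δ / N := by
    rw [hδ]
    field_simp
    ring
  rw [hrate]
  -- Positivity of the denominator of the rate, so that the division is not the default value 0.
  have hsum : ∀ {P : Protocol N K F}, P.IsTBESPIR T B E → ∀ k : Fin K,
      0 < entropy P.law (fun ω => P.files ω k) →
        0 < ∑ n, entropy P.law (P.answer k n) := fun hP k hpos => by
    have := (mul_pos hN0 hpos).trans_le (hP.mul_entropy_file_le_sum_answer hK hN k)
    exact pos_of_mul_pos_right this hd.le
  have converse : ∀ P : Protocol N K F, P.IsTBESPIR T B E → ∀ k : Fin K,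
      ((max T E : ℕ) : ℝ) / δ ≤ P.secrecyRate k ∧ P.rate k ≤ δ / N := fun P hP k => by
    have hpos : 0 < entropy P.law (fun ω => P.files ω k) := by
      classical
      have := Fin.pos_iff_nonempty.1 P.L_pos
      rw [Protocol.entropy_file]
      exact Real.log_pos (by exact_mod_cast Fintype.one_lt_card)
    constructor
    · rw [Protocol.secrecyRate, div_le_div_iff₀ hd hpos]
      linarith [hP.mul_entropy_file_le hK hN k]
    · rw [Protocol.rate, div_le_div_iff₀ (hsum hP k hpos) hN0]
      linarith [hP.mul_entropy_file_le_sum_answer hK hN k]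
  refine ⟨converse, fun ρ => ?_⟩
  have k₀ : Fin K := 0
  split_ifs with hρ
  · refine IsGreatest.csSup_eq ⟨?_, ?_⟩
    · obtain ⟨d, hdN⟩ : ∃ d, N = max T E + d + 2 * B := ⟨N - 2 * B - max T E, by omega⟩
      have hdR : (d : ℝ) = δ := by
        rw [hδ, hdN]
        push_cast
        ring
      -- This ε makes H(S) = ρ δ l against H(W_k) = δ l; it is nonnegative exactly when ρ reaches
      -- the threshold.
      obtain ⟨P, l, hl, hP, hS, hk⟩ := exists_isTBESPIR F (K := K) (T := T) (B := B) (E := E)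
        (by omega : 0 < d) hdN.ge (ε := ρ * δ - (max T E : ℕ)) (by
          rw [div_le_iff₀ hd] at hρ
          linarith)
      refine ⟨P, hP, fun k => ⟨?_, (converse P hP k).2.antisymm ?_⟩⟩
      · rw [Protocol.secrecyRate, hS, (hk k).1, hdR]
        field_simp
        ring
      · have hpos : 0 < entropy P.law (fun ω => P.files ω k) := by
          rw [(hk k).1, hdR]
          positivity
        rw [Protocol.rate, div_le_div_iff₀ hN0 (hsum hP k hpos), (hk k).1, hdR]
        linarith [mul_le_mul_of_nonneg_left (hk k).2 hd.le]
    · rintro r ⟨P, hP, h⟩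
      rw [← (h k₀).2]
      exact (converse P hP k₀).2
  -- Below the threshold no scheme exists, and the real supremum of the empty set is 0 by
  -- convention.
  · have hempty : {r : ℝ | ∃ P : Protocol N K F, P.IsTBESPIR T B E ∧
        ∀ k, P.secrecyRate k = ρ ∧ P.rate k = r} = ∅ := by
      refine Set.eq_empty_of_forall_notMem ?_
      rintro r ⟨P, hP, h⟩
      exact hρ ((h k₀).1 ▸ (converse P hP k₀).1)
    rw [capacityTBESPIR, hempty, Real.sSup_empty]
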